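/- Let $E$ be a complex Banach space with topological dual $E'$, and let $\mathcal P(^jE)$ be the space of continuous $j$-homogeneous polynomials $E\to\mathbb C$. For an entire function $f$ on $E$ with Taylor expansion $\sum_n P_n(x-a)$ at $a$, $P_n\in\mathcal P(^nE)$, write $\hat d^nf(a)=n!\,P_n$. A holomorphy type $\Theta$ from $E$ to $\mathbb C$ is a sequence of Banach spaces $(\mathcal P_\Theta(^jE),\|\cdot\|_\Theta)_{j\ge 0}$ such that each $\mathcal P_\Theta(^jE)$ is a vector subspace of $\mathcal P(^jE)$, $\mathcal P_\Theta(^0E)=\mathbb C$ as a normed space, and for some $\sigma\ge 1$ and all $0\le n\le j$, $a\in E$, $P\in\mathcal P_\Theta(^jE)$ one has $\hat d^nP(a)\in\mathcal P_\Theta(^nE)$ and $\|\frac1{n!}\hat d^nP(a)\|_\Theta\le\sigma^j\|P\|_\Theta\|a\|^{j-n}$. For $k\in[1,\infty]$ put $w_k(j)=(\frac{j}{ke})^{j/k}$ if $k<\infty$ (with $0^0=1$) and $w_\infty(j)=1$. For $\rho>0$ let $\|f\|_{\Theta,k,\rho}=\sum_{j\ge0}\rho^{-j}w_k(j)\,\|\frac1{j!}\hat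 d^jf(0)\|_\Theta$. Let $Exp^k_{\Theta,0}(E)$ be the space of all entire functions $f$ on $E$ with $\hat d^jf(0)\in\mathcal P_\Theta(^jE)$ for all $j$ and $\|f\|_{\Theta,k,\rho}<\infty$ for all $\rho>0$, with the locally convex topology generated by the norms $\|\cdot\|_{\Theta,k,\rho}$, $\rho>0$; let $[Exp^k_{\Theta,0}(E)]'$ be its topological dual. $\Theta$ is a $\pi_1$-holomorphy type if for every $j\ge0$ the space $\mathcal P_f(^jE)=\operatorname{span}\{\phi^j:\phi\in E'\}$ is contained in $\mathcal P_\Theta(^jE)$ and dense in it for $\|\cdot\|_\Theta$, and there is $K>0$ with $\|b\,\phi^j\|_\Theta\le K^j\|\phi\|^j|b|$ for all $\phi\in E'$, $b\in\mathbb C$, $j\ge0$. $\Theta$ is a $\pi_{2,k}$-holomorphy type if for every $T\in[Exp^k_{\Theta,0}(E)]'$ the following holds. For $0\le m\le j$ and $P\in\mathcal P_\Theta(^jE)$ with associated symmetric $j$-linear form $\check P$, let $T(\check P\cdot^m)$ be the function that maps $y\in E$ to the value of $T$ at the polynomial $x\mapsto\check P(x,\dots,x,y,\dots,y)$ ($m$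 times $x$, $j-m$ times $y$). Then (1) $T(\check P\cdot^m)\in\mathcal P_\Theta(^{j-m}E)$ for all such $m,j,P$; and (2) whenever $C>0$ and $\rho>0$ satisfy $|T(f)|\le C\|f\|_{\Theta,k,\rho}$ for all $f\in Exp^k_{\Theta,0}(E)$, there is $M>0$ such that $\|T(\check P\cdot^m)\|_\Theta\le C\,M^j\rho^{-m}w_k(m)\|P\|_\Theta$ for all such $m,j,P$. A convolution operator on $Exp^k_{\Theta,0}(E)$ is a continuous linear map $L$ of this space into itself such that, for all $f$ in the space and all $a\in E$, the function $df(\cdot)a$ is in the space and $d(Lf)(\cdot)a=L(df(\cdot)a)$. A continuous linear map $L:X\to X$ on a topological vector space is mixing if for all non-empty open $U,V\subset X$ there is $n_0$ with $L^n(U)\cap V\ne\emptyset$ for all $n\ge n_0$. **Theorem.** Let $k\in(1,\infty]$, let $E'$ be separable, let $\Theta$ be both a $\pi_1$- and a $\pi_{2,k}$-holomorphy type from $E$ to $\mathbb C$, and let $T\in[Exp^k_{\Theta,0}(E)]'$ not be a scalar multiple of $\delta_0:f\mapsto f(0)$. Then for all $f\in Exp^k_{\Theta,0}(E)$ and $x\in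 E$ the translate $\tau_{-x}f:z\mapsto f(z+x)$ belongs to $Exp^k_{\Theta,0}(E)$, and the formula $(T*f)(x)=T(\tau_{-x}f)$ defines a convolution operator $\Gamma(T)=T*$ on $Exp^k_{\Theta,0}(E)$; this operator is not a scalar multiple of the identity, and it is mixing. -/

import Mathlib

open Set Filter Topology
open scoped ENNReal

namespace HolType

section Polynomials

variable {E : Type*} [NormedAddCommGroup E] [NormedSpace ℂ E]

/-- The polynomial `B̂ : x ↦ B(x, …, x)` of a continuous `j`-linear form `B`. -/
noncomputable def diag {j : ℕ} (B : ContinuousMultilinearMap ℂ (fun _ : Fin j => E) ℂ) : E → ℂ :=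
  fun x => B (fun _ => x)

/-- `B` is a symmetric `j`-linear form. -/
def IsSymm {j : ℕ} (B : ContinuousMultilinearMap ℂ (fun _ : Fin j => E) ℂ) : Prop :=
  ∀ (e : Equiv.Perm (Fin j)) (v : Fin j → E), B (fun i => v (e i)) = B v

/-- `B ·ᵐ y^{j-m}`: the polynomial `x ↦ B(x, …, x, y, …, y)` with `m` entries `x` and
`j - m` entries `y` (used for `m ≤ j`). -/
noncomputable def partialDiag {j : ℕ} (B : ContinuousMultilinearMap ℂ (fun _ : Fin j => E) ℂ) (m : ℕ) (y : E) :
    E → ℂ :=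
  fun x => B (fun i => if (i : ℕ) < m then x else y)

variable (E) in
/-- The space `P(ʲE)` of continuous `j`-homogeneous polynomials from `E` to `ℂ`. -/
def contPoly (j : ℕ) : Submodule ℂ (E → ℂ) where
  carrier := {P | ∃ B : ContinuousMultilinearMap ℂ (fun _ : Fin j => E) ℂ, P = diag B}
  add_mem' := by
    rintro _ _ ⟨B, rfl⟩ ⟨C, rfl⟩
    exact ⟨B + C, by ext x; simp [diag]⟩
  zero_mem' := ⟨0, by ext x; simp [diag]⟩
  smul_mem' := by
    rintro c _ ⟨B, rfl⟩
    exact ⟨c • B, by ext x; simp [diag]⟩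

variable (E) in
/-- The space of polynomials of finite type of degree `j`: the span of the `φ^j`, `φ ∈ E'`. -/
def finitePoly (j : ℕ) : Submodule ℂ (E → ℂ) :=
  Submodule.span ℂ (Set.range fun φ : E →L[ℂ] ℂ => fun x : E => (φ x) ^ j)

/-- The `n`-th derivative `d̂ⁿf(a)` of `f` at `a`, as an `n`-homogeneous polynomial: for
`f` holomorphic with Taylor expansion `∑ Pₙ(x - a)` at `a`, it is `n! Pₙ`. -/
noncomputable def dhat (n : ℕ) (f : E → ℂ) (a : E) : E → ℂ :=
  fun x => iteratedFDeriv ℂ n f a (fun _ => x)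

/-- `f` is an entire function on `E`. -/
def Entire (f : E → ℂ) : Prop := AnalyticOnNhd ℂ f univ

theorem dhat_add (n : ℕ) {f g : E → ℂ} (hf : Entire f) (hg : Entire g) (a : E) :
    dhat n (f + g) a = dhat n f a + dhat n g a := by
  ext x
  simp only [dhat, Pi.add_apply]
  rw [iteratedFDeriv_add_apply hf.contDiff.contDiffAt hg.contDiff.contDiffAt]
  rfl

theorem dhat_smul (n : ℕ) (c : ℂ) {f : E → ℂ} (hf : Entire f) (a : E) :
    dhat n (c • f) a = c • dhat n f a := by
  ext x
  simp only [dhat, Pi.smul_apply]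
  rw [iteratedFDeriv_const_smul_apply hf.contDiff.contDiffAt]
  rfl

theorem dhat_zero_fun (n : ℕ) (a : E) : dhat n (0 : E → ℂ) a = 0 := by
  ext x
  have h := congrFun (dhat_smul n 0 (f := (0 : E → ℂ)) (fun _ _ => analyticAt_const) a) x
  simpa using h

theorem entire_diag {j : ℕ} (B : ContinuousMultilinearMap ℂ (fun _ : Fin j => E) ℂ) :
    Entire (diag B) := by
  intro x _
  have h : AnalyticAt ℂ (fun v : Fin j → E => B v) (fun _ => x) := B.analyticAt
  exact h.comp (f := fun x : E => (fun _ : Fin j => x))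
    ((ContinuousLinearMap.pi fun _ : Fin j => ContinuousLinearMap.id ℂ E).analyticAt x)

/-- The Taylor coefficients at `0` of a homogeneous polynomial. -/
theorem dhat_diag {j : ℕ} (B : ContinuousMultilinearMap ℂ (fun _ : Fin j => E) ℂ) (n : ℕ) :
    dhat n (diag B) 0 = if n = j then (j.factorial : ℂ) • diag B else 0 := by
  let p : FormalMultilinearSeries ℂ E ℂ := fun n => if h : j = n then h ▸ B else 0
  have hp : ∀ n, n ≠ j → p n = 0 := fun n h => dif_neg fun h' => h h'.symm
  have hpj : p j = B := by simp [p]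
  have hs : HasFPowerSeriesOnBall (diag B) p 0 ⊤ := by
    refine ⟨?_, by simp, fun {y} _ => ?_⟩
    · rw [FormalMultilinearSeries.radius_eq_top_of_eventually_eq_zero]
      filter_upwards [eventually_gt_atTop j] with n hn
      exact hp n hn.ne'
    · have h := hasSum_single (f := fun n => p n fun _ => y) j
        (fun n hn => by simp [hp n hn])
      simpa [hpj, diag] using h
  ext x
  have h := hs.factorial_smul x n
  simp only [dhat]
  rw [← h]
  split_ifs with hn
  · subst hn
    simp [hpj, diag]
  · simp [hp n hn]

theorem hasDerivAt_partialDiag {j : ℕ} (B : ContinuousMultilinearMap ℂ (fun _ : Fin j => E) ℂ)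
    (hB : IsSymm B) (m : ℕ) (hm : m < j) (x y : E) :
    HasDerivAt (fun t : ℂ => partialDiag B m (y + t • x) x)
      (((j - m : ℕ) : ℂ) * partialDiag B (m + 1) y x) 0 := by
  have hg : ∀ i : Fin j, HasDerivAt (fun t : ℂ => if (i : ℕ) < m then x else y + t • x)
      (if (i : ℕ) < m then 0 else x) 0 := by
    intro i
    split_ifs
    · exact hasDerivAt_const _ _
    · simpa using ((hasDerivAt_id (0 : ℂ)).smul_const x).const_add y
  have h := (HasFDerivAt.multilinear_comp (f := B) (fun i => (hg i).hasFDerivAt)).hasDerivAt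
  refine h.congr_deriv ?_
  have key : ∀ i : Fin j,
      B (Function.update (fun l : Fin j => if (l : ℕ) < m then x else y) i
        (if (i : ℕ) < m then 0 else x)) = if (i : ℕ) < m then 0 else partialDiag B (m + 1) y x := by
    intro i
    split_ifs with hi
    · exact B.map_coord_zero i (by simp)
    · rw [partialDiag, ← hB (Equiv.swap i ⟨m, hm⟩)]
      congr 1
      ext l
      by_cases hl : l = ⟨m, hm⟩
      · subst hl
        simp
      · have hl' : (l : ℕ) ≠ m := fun h' => hl (Fin.ext h')
        have h2 : (l : ℕ) < m + 1 ↔ (l : ℕ) < m := by omega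
        by_cases hi' : l = i
        · subst hi'
          rw [Equiv.swap_apply_left, Function.update_of_ne (Ne.symm hl)]
          simp [h2, hi]
        · rw [Equiv.swap_apply_of_ne_of_ne hi' hl, Function.update_of_ne hi']
          simp only [h2]
  have hc : (Finset.univ.filter fun i : Fin j => ¬ (i : ℕ) < m).card = j - m := by
    have h1 := Finset.card_filter_add_card_filter_not (s := (Finset.univ : Finset (Fin j)))
      (fun i : Fin j => (i : ℕ) < m)
    have h2 : (Finset.univ.filter fun i : Fin j => (i : ℕ) < m).card = m := by
      simpa [hm.le] using Fin.card_filter_val_lt (m := m) (n := j)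
    simp only [Finset.card_univ, Fintype.card_fin] at h1
    omega
  simp only [sum_apply, ContinuousLinearMap.comp_apply,
    ContinuousMultilinearMap.toContinuousLinearMap_apply, zero_smul, add_zero,
    ContinuousLinearMap.toSpanSingleton_apply, one_smul]
  rw [Finset.sum_congr rfl fun i _ => key i]
  simp [Finset.sum_ite, ← hc]

/-- `d̂ᵐB̂(y)(x) = j!/(j-m)! · B(xᵐ, y^{j-m})` for a symmetric `j`-linear form `B`. -/
theorem dhat_diag_eq {j : ℕ} (B : ContinuousMultilinearMap ℂ (fun _ : Fin j => E) ℂ)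
    (hB : IsSymm B) (m : ℕ) (hm : m ≤ j) (y : E) :
    dhat m (diag B) y = (j.descFactorial m : ℂ) • partialDiag B m y := by
  induction m generalizing y with
  | zero =>
    ext x
    simp [dhat, partialDiag, diag]
  | succ m ih =>
    ext x
    have hd : DifferentiableAt ℂ (iteratedFDeriv ℂ m (diag B)) y :=
      ((entire_diag B).contDiff (n := ⊤)).differentiable_iteratedFDeriv (by simp) y
    have h1 : HasDerivAt (fun t : ℂ => iteratedFDeriv ℂ m (diag B) (y + t • x) (fun _ => x))
        (dhat (m + 1) (diag B) y x) 0 := by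
      have hl : HasDerivAt (fun t : ℂ => y + t • x) x 0 := by
        simpa using ((hasDerivAt_id (0 : ℂ)).smul_const x).const_add y
      have h2 : HasFDerivAt (iteratedFDeriv ℂ m (diag B))
          (fderiv ℂ (iteratedFDeriv ℂ m (diag B)) y) (y + (0 : ℂ) • x) := by
        simpa using hd.hasFDerivAt
      have h3 := h2.comp_hasDerivAt (0 : ℂ) hl
      have h4 := ((ContinuousMultilinearMap.apply ℂ (fun _ : Fin m => E) ℂ
        (fun _ => x)).hasFDerivAt).comp_hasDerivAt (0 : ℂ) h3
      exact h4
    have h5 : HasDerivAt (fun t : ℂ => iteratedFDeriv ℂ m (diag B) (y + t • x) (fun _ => x))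
        ((j.descFactorial m : ℂ) * (((j - m : ℕ) : ℂ) * partialDiag B (m + 1) y x)) 0 := by
      refine ((hasDerivAt_partialDiag B hB m (by omega) x y).const_mul _).congr_of_eventuallyEq ?_
      refine Eventually.of_forall fun t => ?_
      have := congrFun (ih (by omega) (y + t • x)) x
      simpa [dhat] using this
    rw [h1.unique h5, Nat.descFactorial_succ]
    simp only [Pi.smul_apply, smul_eq_mul]
    push_cast
    ring

end Polynomials

section HolomorphyType

variable (E : Type*) [NormedAddCommGroup E] [NormedSpace ℂ E]

/-- A holomorphy type `Θ` from `E` to `ℂ`: a sequence of Banach spaces `P_Θ(ʲE)`, each of them a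
vector subspace of `P(ʲE)` with a norm of its own. -/
structure HolomorphyType where
  /-- The space `P_Θ(ʲE)`. -/
  space : ℕ → Submodule ℂ (E → ℂ)
  /-- The norm `‖·‖_Θ` of `P_Θ(ʲE)`. -/
  nrm : ∀ j : ℕ, Seminorm ℂ (space j)
  /-- `‖·‖_Θ` is a norm. -/
  eq_zero_of_nrm : ∀ (i : ℕ) (P : space i), nrm i P = 0 → P = 0
  /-- `P_Θ(ʲE)` is complete. -/
  complete : ∀ (j : ℕ) (u : ℕ → space j),
    (∀ ε > 0, ∃ N, ∀ p ≥ N, ∀ q ≥ N, nrm j (u p - u q) < ε) →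
    ∃ P : space j, Tendsto (fun n => nrm j (u n - P)) atTop (𝓝 0)
  space_le : ∀ j : ℕ, space j ≤ contPoly E j
  /-- `P_Θ(⁰E)` consists of all constants … -/
  space_zero : ∀ P : E → ℂ, P ∈ space 0 ↔ ∃ c : ℂ, P = fun _ => c
  /-- … with the norm of `ℂ`. -/
  nrm_zero : ∀ (c : ℂ) (h : (fun _ : E => c) ∈ space 0), nrm 0 ⟨fun _ => c, h⟩ = ‖c‖
  /-- The derivatives of a `Θ`-polynomial are `Θ`-polynomials, with control of the norms. -/
  deriv_bound : ∃ σ : ℝ, 1 ≤ σ ∧ ∀ (n j : ℕ), n ≤ j → ∀ (a : E) (P : space j),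
    ∃ h : dhat n (P : E → ℂ) a ∈ space n,
      nrm n ((n.factorial : ℂ)⁻¹ • ⟨dhat n (P : E → ℂ) a, h⟩) ≤ σ ^ j * nrm j P * ‖a‖ ^ (j - n)

variable {E}

/-- `π₁`-holomorphy types. -/
def IsPi1 (Θ : HolomorphyType E) : Prop :=
  (∀ j, finitePoly E j ≤ Θ.space j) ∧
  (∃ K : ℝ, 0 < K ∧ ∀ (j : ℕ) (φ : E →L[ℂ] ℂ) (b : ℂ),
    ∃ h : (fun x : E => (φ x) ^ j * b) ∈ Θ.space j,
      Θ.nrm j ⟨fun x : E => (φ x) ^ j * b, h⟩ ≤ K ^ j * ‖φ‖ ^ j * ‖b‖) ∧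
  ∀ (j : ℕ) (P : Θ.space j), ∀ ε > 0,
    ∃ Q : Θ.space j, (Q : E → ℂ) ∈ finitePoly E j ∧ Θ.nrm j (P - Q) < ε

end HolomorphyType

section ExpSpaces

variable {E : Type*} [NormedAddCommGroup E] [NormedSpace ℂ E]

/-- The weight `(j / (k e))^{j/k}`, with `0⁰ = 1`; it is `1` for `k = ∞`. -/
noncomputable def weight (k : ℝ≥0∞) (j : ℕ) : ℝ :=
  if k = ⊤ then 1 else ((j : ℝ) / (k.toReal * Real.exp 1)) ^ ((j : ℝ) / k.toReal)

theorem weight_nonneg (k : ℝ≥0∞) (j : ℕ) : 0 ≤ weight k j := by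
  unfold weight
  split_ifs
  · exact zero_le_one
  · positivity

/-- The space `B^k_{Θ,ρ}(E)`, `ρ > 0`, of all entire `f` with `d̂ʲf(0) ∈ P_Θ(ʲE)` for all `j` and
`∑ ρ^{-j} (j/(ke))^{j/k} ‖d̂ʲf(0)/j!‖_Θ < ∞`. -/
def boundedType (Θ : HolomorphyType E) (k : ℝ≥0∞) (ρ : Set.Ioi (0 : ℝ)) :
    Submodule ℂ (E → ℂ) where
  carrier := {f | Entire f ∧ ∃ h : ∀ j, dhat j f 0 ∈ Θ.space j,
    Summable fun j : ℕ => ((ρ : ℝ) ^ j)⁻¹ * weight k j *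
      Θ.nrm j ((j.factorial : ℂ)⁻¹ • ⟨dhat j f 0, h j⟩)}
  add_mem' := by
    rintro f g ⟨hf, hf', hfs⟩ ⟨hg, hg', hgs⟩
    have h : ∀ j, dhat j (f + g) 0 ∈ Θ.space j := fun j => by
      rw [dhat_add j hf hg]
      exact (Θ.space j).add_mem (hf' j) (hg' j)
    refine ⟨hf.add hg, h, Summable.of_nonneg_of_le (fun j => ?_) (fun j => ?_) (hfs.add hgs)⟩
    · have := weight_nonneg k j
      have := ρ.2.out
      positivity
    · have e : (⟨dhat j (f + g) 0, h j⟩ : Θ.space j) = ⟨dhat j f 0, hf' j⟩ + ⟨dhat j g 0, hg' j⟩ :=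
        Subtype.ext (dhat_add j hf hg 0)
      rw [e, smul_add, ← mul_add]
      have := weight_nonneg k j
      have := ρ.2.out
      exact mul_le_mul_of_nonneg_left (map_add_le_add _ _ _) (by positivity)
  zero_mem' := by
    have h : ∀ j, dhat j (0 : E → ℂ) 0 ∈ Θ.space j := fun j => by
      rw [dhat_zero_fun]
      exact (Θ.space j).zero_mem
    refine ⟨fun _ _ => analyticAt_const, h, ?_⟩
    have e : ∀ j, (⟨dhat j (0 : E → ℂ) 0, h j⟩ : Θ.space j) = 0 := fun j =>
      Subtype.ext (dhat_zero_fun j 0)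
    simp [e, summable_zero]
  smul_mem' := by
    rintro c f ⟨hf, hf', hfs⟩
    have h : ∀ j, dhat j (c • f) 0 ∈ Θ.space j := fun j => by
      rw [dhat_smul j c hf]
      exact (Θ.space j).smul_mem c (hf' j)
    refine ⟨fun x hx => (hf x hx).const_smul, h, (hfs.mul_left ‖c‖).congr fun j => ?_⟩
    have e : (⟨dhat j (c • f) 0, h j⟩ : Θ.space j) = c • ⟨dhat j f 0, hf' j⟩ :=
      Subtype.ext (dhat_smul j c hf 0)
    rw [e, smul_comm _ c, map_smul_eq_mul (Θ.nrm j) c]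
    ring

/-- The space `Exp^k_{Θ,0}(E)`, the intersection of the spaces `B^k_{Θ,ρ}(E)`, `ρ > 0`. For `k = ∞`
the root test shows that the summability for all `ρ > 0` means that
`limsup ‖d̂ʲf(0)/j!‖_Θ^{1/j} ≤ 0`. -/
def expSubmodule (Θ : HolomorphyType E) (k : ℝ≥0∞) : Submodule ℂ (E → ℂ) :=
  ⨅ ρ : Set.Ioi (0 : ℝ), boundedType Θ k ρ

/-- `Exp^k_{Θ,0}(E)` as a type, to carry its own topology. -/
def ExpSpace (Θ : HolomorphyType E) (k : ℝ≥0∞) : Type _ := expSubmodule Θ k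

namespace ExpSpace

variable {Θ : HolomorphyType E} {k : ℝ≥0∞}

noncomputable instance : AddCommGroup (ExpSpace Θ k) :=
  inferInstanceAs (AddCommGroup (expSubmodule Θ k))

noncomputable instance : Module ℂ (ExpSpace Θ k) :=
  inferInstanceAs (Module ℂ (expSubmodule Θ k))

instance : CoeFun (ExpSpace Θ k) (fun _ => E → ℂ) := ⟨fun f => f.1⟩

theorem mem_boundedType (f : ExpSpace Θ k) (ρ : Set.Ioi (0 : ℝ)) : f.1 ∈ boundedType Θ k ρ :=
  (Submodule.mem_iInf _).1 f.2 ρ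

theorem entire (f : ExpSpace Θ k) : Entire f.1 := (f.mem_boundedType ⟨1, Set.mem_Ioi.2 one_pos⟩).1

theorem dhat_mem (f : ExpSpace Θ k) (j : ℕ) : dhat j f.1 0 ∈ Θ.space j :=
  (f.mem_boundedType ⟨1, Set.mem_Ioi.2 one_pos⟩).2.1 j

/-- The Taylor coefficient `d̂ʲf(0)/j!` as an element of `P_Θ(ʲE)`. -/
noncomputable def taylor (j : ℕ) : ExpSpace Θ k →ₗ[ℂ] Θ.space j where
  toFun f := (j.factorial : ℂ)⁻¹ • ⟨dhat j f.1 0, f.dhat_mem j⟩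
  map_add' f g := by
    rw [← smul_add]
    congr 1
    exact Subtype.ext (dhat_add j f.entire g.entire 0)
  map_smul' c f := by
    rw [RingHom.id_apply, smul_comm c]
    congr 1
    exact Subtype.ext (dhat_smul j c f.entire 0)

theorem summable_taylor (f : ExpSpace Θ k) (ρ : Set.Ioi (0 : ℝ)) :
    Summable fun j : ℕ => ((ρ : ℝ) ^ j)⁻¹ * weight k j * Θ.nrm j (taylor j f) :=
  (f.mem_boundedType ρ).2.2

/-- The norm `‖f‖_{Θ,k,ρ} = ∑ ρ^{-j} (j/(ke))^{j/k} ‖d̂ʲf(0)/j!‖_Θ` (it is `p^∞_{Θ,ρ}` for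
`k = ∞`). -/
noncomputable def expNorm (Θ : HolomorphyType E) (k : ℝ≥0∞) :
    SeminormFamily ℂ (ExpSpace Θ k) (Set.Ioi (0 : ℝ)) := fun ρ =>
  Seminorm.of (fun f => ∑' j : ℕ, ((ρ : ℝ) ^ j)⁻¹ * weight k j * Θ.nrm j (taylor j f))
    (fun f g => by
      rw [← (f.summable_taylor ρ).tsum_add (g.summable_taylor ρ)]
      refine ((f + g).summable_taylor ρ).tsum_le_tsum (fun j => ?_)
        ((f.summable_taylor ρ).add (g.summable_taylor ρ))
      have := weight_nonneg k j
      have := ρ.2.out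
      rw [map_add, ← mul_add]
      exact mul_le_mul_of_nonneg_left (map_add_le_add _ _ _) (by positivity))
    (fun c f => by
      rw [← tsum_mul_left]
      refine tsum_congr fun j => ?_
      rw [map_smul, map_smul_eq_mul]
      ring)

/-- The projective limit topology: the locally convex topology generated by the norms
`‖·‖_{Θ,k,ρ}`, `ρ > 0`. -/
noncomputable instance : TopologicalSpace (ExpSpace Θ k) :=
  (expNorm Θ k).moduleFilterBasis.topology

theorem withSeminorms : WithSeminorms (expNorm Θ k) := ⟨rfl⟩

end ExpSpace

/-- The polynomials in `P_Θ(ʲE)` belong to `Exp^k_{Θ,0}(E)`. -/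
theorem mem_expSubmodule_of_mem_space (Θ : HolomorphyType E) (k : ℝ≥0∞) {m : ℕ} {P : E → ℂ}
    (hP : P ∈ Θ.space m) : P ∈ expSubmodule Θ k := by
  obtain ⟨B, rfl⟩ := Θ.space_le m hP
  have h : ∀ j, dhat j (diag B) 0 ∈ Θ.space j := fun j => by
    rw [dhat_diag]
    split_ifs with hj
    · subst hj
      exact (Θ.space j).smul_mem _ hP
    · exact (Θ.space j).zero_mem
  refine (Submodule.mem_iInf _).2 fun ρ => ⟨entire_diag B, h, ?_⟩
  refine summable_of_ne_finset_zero (s := {m}) fun j hj => ?_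
  have hj' : j ≠ m := by simpa using hj
  have e : (⟨dhat j (diag B) 0, h j⟩ : Θ.space j) = 0 :=
    Subtype.ext ((dhat_diag B j).trans (if_neg hj'))
  rw [e, smul_zero, map_zero, mul_zero]

/-- If `B` is a symmetric `j`-linear form with `B̂ ∈ P_Θ(ʲE)`, then `B ·ᵐ y^{j-m} ∈ P_Θ(ᵐE)`. -/
theorem partialDiag_mem_space (Θ : HolomorphyType E) {j m : ℕ} (hm : m ≤ j)
    {B : ContinuousMultilinearMap ℂ (fun _ : Fin j => E) ℂ} (hB : IsSymm B)
    (hP : diag B ∈ Θ.space j) (y : E) : partialDiag B m y ∈ Θ.space m := by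
  obtain ⟨σ, -, h⟩ := Θ.deriv_bound
  obtain ⟨h1, -⟩ := h m j hm y ⟨diag B, hP⟩
  have h0 : (j.descFactorial m : ℂ) ≠ 0 :=
    Nat.cast_ne_zero.2 (Nat.descFactorial_pos.2 hm).ne'
  have h2 := (Θ.space m).smul_mem (j.descFactorial m : ℂ)⁻¹ h1
  rw [dhat_diag_eq B hB m hm y, smul_smul, inv_mul_cancel₀ h0, one_smul] at h2
  exact h2

/-- `B ·ᵐ y^{j-m}` as an element of `Exp^k_{Θ,0}(E)`. -/
noncomputable def partialExp (Θ : HolomorphyType E) (k : ℝ≥0∞) {j m : ℕ} (hm : m ≤ j)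
    {B : ContinuousMultilinearMap ℂ (fun _ : Fin j => E) ℂ} (hB : IsSymm B)
    (hP : diag B ∈ Θ.space j) (y : E) : ExpSpace Θ k :=
  ⟨partialDiag B m y, mem_expSubmodule_of_mem_space Θ k (partialDiag_mem_space Θ hm hB hP y)⟩

/-- `π_{2,k}`-holomorphy types (for the spaces of type `A = 0`). Here `B̂` runs over the polynomials
`P ∈ P_Θ(ʲE)`, with `B` the symmetric `j`-linear form of `P`, and `T(B·ᵐ)` is the polynomial
`y ↦ T(B ·ᵐ y^{j-m})`. -/
def IsPi2 (Θ : HolomorphyType E) (k : ℝ≥0∞) : Prop :=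
  ∀ T : ExpSpace Θ k →L[ℂ] ℂ,
    ∃ hT : ∀ (j m : ℕ) (hm : m ≤ j) (B : ContinuousMultilinearMap ℂ (fun _ : Fin j => E) ℂ)
        (hB : IsSymm B) (hP : diag B ∈ Θ.space j),
        (fun y => T (partialExp Θ k hm hB hP y)) ∈ Θ.space (j - m),
      ∀ (C : ℝ) (ρ : Set.Ioi (0 : ℝ)), 0 < C → (∀ f, ‖T f‖ ≤ C * ExpSpace.expNorm Θ k ρ f) →
        ∃ M : ℝ, 0 < M ∧
          ∀ (j m : ℕ) (hm : m ≤ j) (B : ContinuousMultilinearMap ℂ (fun _ : Fin j => E) ℂ)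
            (hB : IsSymm B) (hP : diag B ∈ Θ.space j),
            Θ.nrm (j - m) ⟨fun y => T (partialExp Θ k hm hB hP y), hT j m hm B hB hP⟩ ≤
              C * M ^ j * ((ρ : ℝ) ^ m)⁻¹ * weight k m * Θ.nrm j ⟨diag B, hP⟩

/-- `L` is a convolution operator on `Exp^k_{Θ,0}(E)`: for all `f` and all `a ∈ E` the directional
derivative `df(·)a` is in `Exp^k_{Θ,0}(E)`, and `L (df(·)a) = d(Lf)(·)a`. -/
def IsConvolutionOperator {Θ : HolomorphyType E} {k : ℝ≥0∞}
    (L : ExpSpace Θ k →L[ℂ] ExpSpace Θ k) : Prop :=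
  ∀ (f : ExpSpace Θ k) (a : E), ∃ h : (fun x => fderiv ℂ f x a) ∈ expSubmodule Θ k,
    ∀ x, L ⟨fun x => fderiv ℂ f x a, h⟩ x = fderiv ℂ (L f) x a

/-- `L` is the operator `Γ(T) = T∗`: for all `f` and all `x ∈ E` the translate
`τ_{-x}f : z ↦ f(z + x)` is in `Exp^k_{Θ,0}(E)`, and `(L f)(x) = T(τ_{-x}f)`. -/
def IsConvolutionWith {Θ : HolomorphyType E} {k : ℝ≥0∞} (T : ExpSpace Θ k →L[ℂ] ℂ)
    (L : ExpSpace Θ k →L[ℂ] ExpSpace Θ k) : Prop :=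
  ∀ (f : ExpSpace Θ k) (x : E), ∃ h : (fun z => f (z + x)) ∈ expSubmodule Θ k,
    L f x = T ⟨fun z => f (z + x), h⟩

end ExpSpaces

/-- A continuous linear operator `L` is mixing. -/
def IsMixing {X : Type*} [AddCommGroup X] [Module ℂ X] [TopologicalSpace X] (L : X →L[ℂ] X) :
    Prop :=
  ∀ U V : Set X, IsOpen U → U.Nonempty → IsOpen V → V.Nonempty →
    ∃ n₀ : ℕ, ∀ n ≥ n₀, (((⇑L)^[n] '' U) ∩ V).Nonempty

end HolType

/-! The proof is a Godefroy–Shapiro argument. For `φ ∈ E'` the translate of `e^φ` by `x` is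
`e^{φ(x)} e^φ`, so `e^φ` is an eigenvector of `T*` with eigenvalue `T(e^φ)`. An operator is mixing
as soon as the eigenvectors with eigenvalue of modulus `< 1` span a dense subspace, and those with
modulus `> 1` do too (`isMixing_of_dense_eigenvectors`).

The exponentials lie in the space because `w_k(n)/n!` decays faster than any geometric sequence;
this is where `k > 1` enters. The Borel transform `φ ↦ T(e^φ)` is holomorphic on every complex line
(`differentiable_expFun`). If it were constant on each line through `0`, then comparing coefficients
would give `T(φⁿ) = 0` for `n ≥ 1`. Density of the finite-type polynomials and convergence of Taylor
series would then make `T` a multiple of `δ₀` (`exists_eq_mul_of_map_expFun_eq`). So it is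
non-constant on some line, and Liouville's theorem yields values of modulus `> 1` and `< 1`. Near
such a point the inequality persists along every line, and exponentials taken from such a set of `φ`
have dense span, by Hahn–Banach and the identity theorem (`expFun_dense`).

It remains to see that `T*` exists and is continuous. With `B_j` the symmetric form of the `j`-th
Taylor coefficient of `f`, one has `(T*f)(x) = ∑ (n+m choose m) T(B_{n+m}(·ᵐ, xⁿ))`. The `π_{2,k}`
condition places each term in `P_Θ(ⁿE)` and bounds its norm. With `w_k(n) w_k(m) ≤ w_k(n+m)` the
double series is dominated by a norm `‖f‖_{Θ,k,ρ'}` (`exists_convolution`). Commutation with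
derivatives follows on differentiating `t ↦ T(τ_{-ta}u)` at `0`, with `u = τ_{-x}f`. -/

namespace HolType

/-! ### Symmetric multilinear forms and polarization -/

section SymmetricForms

variable {E : Type*} [NormedAddCommGroup E] [NormedSpace ℂ E] {j : ℕ}

/-- Every continuous `j`-homogeneous polynomial comes from a symmetric form. -/
theorem exists_isSymm_diag_eq {P : E → ℂ} (hP : P ∈ contPoly E j) :
    ∃ B : ContinuousMultilinearMap ℂ (fun _ : Fin j => E) ℂ, IsSymm B ∧ diag B = P := by
  obtain ⟨B, rfl⟩ := hP
  refine ⟨(j.factorial : ℂ)⁻¹ • ∑ σ : Equiv.Perm (Fin j), B.domDomCongr σ, fun e v => ?_, ?_⟩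
  · simp only [smul_apply, sum_apply,
      ContinuousMultilinearMap.domDomCongr_apply]
    congr 1
    exact Fintype.sum_equiv (Equiv.mulLeft e) _ _ fun σ => rfl
  · ext x
    have : (j.factorial : ℂ) ≠ 0 := Nat.cast_ne_zero.2 j.factorial_ne_zero
    simp [diag, Fintype.card_perm, this]

variable {B : ContinuousMultilinearMap ℂ (fun _ : Fin j => E) ℂ}

/-- The polarization formula. -/
theorem IsSymm.factorial_mul_eq_sum (hB : IsSymm B) (x : Fin j → E) :
    (j.factorial : ℂ) * B x = ∑ t ∈ (Finset.univ : Finset (Fin j)).powerset,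
      (-1 : ℤ) ^ t.card • diag B (∑ i ∈ tᶜ, x i) := by
  classical
  -- Inclusion–exclusion over the self-maps `r` of `Fin j`. Those that miss no index are the
  -- permutations, each contributing `B x` by symmetry. Those that miss every index of `t` add up to
  -- the value of the polynomial at `∑ i ∈ tᶜ, x i`.
  have h := Finset.inclusion_exclusion_sum_inf_compl Finset.univ
    (fun i : Fin j => Finset.univ.filter fun r : Fin j → Fin j => ∀ l, r l ≠ i)
    (fun r => B fun l => x (r l))
  have hl : (Finset.univ.inf fun i : Fin j =>
      (Finset.univ.filter fun r : Fin j → Fin j => ∀ l, r l ≠ i)ᶜ) =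
      Finset.univ.filter Function.Bijective := by
    ext r
    simp only [Finset.mem_inf, Finset.mem_univ, true_implies, Finset.mem_compl, Finset.mem_filter,
      true_and, ← Finite.surjective_iff_bijective, Function.Surjective]
    simp
  have hs : ∑ r ∈ Finset.univ.filter (Function.Bijective : (Fin j → Fin j) → Prop),
      (B fun l => x (r l)) = (j.factorial : ℂ) * B x := by
    have : ∑ r ∈ Finset.univ.filter (Function.Bijective : (Fin j → Fin j) → Prop),
        (B fun l => x (r l)) = ∑ e : Equiv.Perm (Fin j), B fun l => x (e l) := by
      symm
      refine Finset.sum_bij (fun e _ => ⇑e) (fun e _ => Finset.mem_filter.2 ⟨Finset.mem_univ _, e.bijective⟩)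
        (fun e _ e' _ h => DFunLike.coe_injective h) (fun r hr => ?_) (fun _ _ => rfl)
      exact ⟨Equiv.ofBijective r (Finset.mem_filter.1 hr).2, Finset.mem_univ _, rfl⟩
    rw [this, Finset.sum_congr rfl fun e _ => hB e x]
    simp [Fintype.card_perm]
  rw [hl, hs] at h
  rw [h]
  refine Finset.sum_congr rfl fun t _ => ?_
  congr 1
  have ht : (t.inf fun i : Fin j => Finset.univ.filter fun r : Fin j → Fin j => ∀ l, r l ≠ i) =
      Fintype.piFinset fun _ => tᶜ := by
    ext r
    simp only [Finset.mem_inf, Finset.mem_filter, Finset.mem_univ, true_and,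
      Fintype.mem_piFinset, Finset.mem_compl]
    exact ⟨fun h l hl => h _ hl l rfl, fun h i hi l hl => h l (hl ▸ hi)⟩
  rw [ht, diag]
  exact (B.toMultilinearMap.map_sum_finset (fun _ i => x i) (fun _ => tᶜ)).symm

/-- The polarization inequality. -/
theorem IsSymm.norm_le (hB : IsSymm B) {c : ℝ} (hc0 : 0 ≤ c)
    (hc : ∀ x, ‖diag B x‖ ≤ c * ‖x‖ ^ j) : ‖B‖ ≤ (2 * Real.exp 1) ^ j * c := by
  have key : ∀ x : Fin j → E, (∀ i, ‖x i‖ ≤ 1) → ‖B x‖ ≤ (2 * Real.exp 1) ^ j * c := by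
    intro x hx
    have hf : (0 : ℝ) < j.factorial := Nat.cast_pos.2 j.factorial_pos
    -- The polarization sum has `2 ^ j` terms, each evaluated at a vector of norm at most `j`; then
    -- `j ^ j ≤ e ^ j * j!` gives the constant `(2e) ^ j`.
    have h1 : ‖(j.factorial : ℂ) * B x‖ ≤ 2 ^ j * (c * (j : ℝ) ^ j) := by
      rw [hB.factorial_mul_eq_sum x]
      refine (norm_sum_le_of_le _ (f := fun t => (-1 : ℤ) ^ t.card • diag B (∑ i ∈ tᶜ, x i))
        (n := fun _ => c * (j : ℝ) ^ j) fun t _ => ?_).trans (by simp)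
      have h2 : ‖∑ i ∈ tᶜ, x i‖ ≤ j := by
        refine (norm_sum_le_of_le _ fun i _ => hx i).trans ?_
        simp only [Finset.sum_const, nsmul_eq_mul, mul_one, Nat.cast_le]
        simpa using Finset.card_le_univ tᶜ
      have h3 : ‖(-1 : ℤ) ^ t.card • diag B (∑ i ∈ tᶜ, x i)‖ = ‖diag B (∑ i ∈ tᶜ, x i)‖ := by
        rcases neg_one_pow_eq_or ℤ t.card with h | h <;> simp [h]
      rw [h3]
      exact (hc _).trans (by gcongr)
    rw [norm_mul, Complex.norm_natCast] at h1
    have h4 : (j : ℝ) ^ j ≤ Real.exp 1 ^ j * j.factorial := by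
      have := Real.pow_div_factorial_le_exp (j : ℝ) (Nat.cast_nonneg j) j
      rw [div_le_iff₀ hf] at this
      rwa [← Real.exp_nat_mul, mul_one]
    have h5 : (j.factorial : ℝ) * ‖B x‖ ≤ j.factorial * ((2 * Real.exp 1) ^ j * c) := by
      refine h1.trans ?_
      rw [mul_pow]
      calc 2 ^ j * (c * (j : ℝ) ^ j) ≤ 2 ^ j * (c * (Real.exp 1 ^ j * j.factorial)) := by gcongr
        _ = _ := by ring
    exact le_of_mul_le_mul_left h5 hf
  refine ContinuousMultilinearMap.opNorm_le_bound (by positivity) fun x => ?_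
  by_cases hx : ∃ i, x i = 0
  · obtain ⟨i, hi⟩ := hx
    rw [B.map_coord_zero i hi, norm_zero]
    positivity
  · push Not at hx
    have h := key (fun i => (‖x i‖ : ℂ)⁻¹ • x i) (fun i => by
      have := norm_ne_zero_iff.2 (hx i)
      simp [norm_smul, this])
    rw [B.map_smul_univ, norm_smul, norm_prod] at h
    simp only [norm_inv, Complex.norm_real, norm_norm, Finset.prod_inv_distrib] at h
    have hp : 0 < ∏ i, ‖x i‖ := Finset.prod_pos fun i _ => norm_pos_iff.2 (hx i)
    rwa [inv_mul_le_iff₀ hp, mul_comm] at h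

/-- Some permutation carries `s` onto the initial segment of the same size, so only the number of
entries `z` matters. -/
theorem IsSymm.piecewise_eq_partialDiag (hB : IsSymm B) (s : Finset (Fin j)) (x z : E) :
    B (s.piecewise (fun _ => z) fun _ => x) = partialDiag B s.card x z := by
  classical
  have hs : s.card ≤ j := by simpa using s.card_le_univ
  have hc : Fintype.card {i // i ∈ s} = Fintype.card {i : Fin j // (i : ℕ) < s.card} := by
    rw [Fintype.card_coe, Fintype.card_subtype]
    simpa [hs] using (Fin.card_filter_val_lt (m := s.card) (n := j)).symm
  let e := Fintype.equivOfCardEq hc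
  rw [partialDiag, ← hB e.extendSubtype fun i => if (i : ℕ) < s.card then z else x]
  congr 1
  ext i
  by_cases hi : i ∈ s
  · have := e.extendSubtype_mem i hi
    rw [Finset.piecewise_eq_of_mem _ _ _ hi, if_pos this]
  · have := e.extendSubtype_not_mem i hi
    rw [Finset.piecewise_eq_of_notMem _ _ _ hi, if_neg this]

/-- The binomial formula. -/
theorem IsSymm.diag_add (hB : IsSymm B) (x z : E) :
    diag B (z + x) = ∑ p ∈ Finset.HasAntidiagonal.antidiagonal j, (j.choose p.1 : ℂ) * partialDiag B p.1 x z := by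
  classical
  have h := B.toMultilinearMap.map_add_univ (fun _ => z) (fun _ => x)
  have h1 : diag B (z + x) = ∑ s ∈ (Finset.univ : Finset (Fin j)).powerset,
      partialDiag B s.card x z := by
    rw [Finset.powerset_univ]
    exact h.trans (Finset.sum_congr rfl fun s _ => hB.piecewise_eq_partialDiag s x z)
  rw [h1, Finset.sum_powerset_apply_card (fun m => partialDiag B m x z),
    Finset.Nat.sum_antidiagonal_eq_sum_range_succ_mk]
  simp

theorem partialDiag_smul {m : ℕ} (hm : m ≤ j) (t : ℂ) (x z : E) :
    partialDiag B m (t • x) z = t ^ (j - m) * partialDiag B m x z := by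
  have h : (fun i : Fin j => if (i : ℕ) < m then z else t • x) =
      fun i : Fin j => (if (i : ℕ) < m then (1 : ℂ) else t) • if (i : ℕ) < m then z else x := by
    ext i
    split_ifs <;> simp
  rw [partialDiag, h, B.map_smul_univ, Finset.prod_ite]
  have h1 : (Finset.univ.filter fun i : Fin j => (i : ℕ) < m).card = m := by
    simpa [hm] using Fin.card_filter_val_lt (m := m) (n := j)
  have h2 := Finset.card_filter_add_card_filter_not (s := (Finset.univ : Finset (Fin j)))
      (fun i : Fin j => (i : ℕ) < m)
  simp only [Finset.card_univ, Fintype.card_fin] at h2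
  simp only [Finset.prod_const_one, Finset.prod_const, one_mul, smul_eq_mul, partialDiag]
  congr 2
  omega

end SymmetricForms

/-! ### Power series and Taylor expansions of entire functions -/

section PowerSeries

variable {E : Type*} [NormedAddCommGroup E] [NormedSpace ℂ E]

/-- A power series of homogeneous polynomials with infinite radius of convergence
has an entire sum, and the terms of the series are the Taylor coefficients of the sum. -/
theorem hasFPowerSeriesOnBall_of_hasSum_diag
    {B : ∀ j, ContinuousMultilinearMap ℂ (fun _ : Fin j => E) ℂ} {c : ℕ → ℝ}
    (hB : ∀ j, IsSymm (B j)) (hc : ∀ j x, ‖diag (B j) x‖ ≤ c j * ‖x‖ ^ j)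
    (hc0 : ∀ j, 0 ≤ c j) (hs : ∀ R : ℝ, 0 < R → Summable fun j => R ^ j * c j)
    {F : E → ℂ} (hF : ∀ x, HasSum (fun j => diag (B j) x) (F x)) :
    HasFPowerSeriesOnBall F (fun j => B j) 0 ⊤ := by
  refine ⟨?_, by simp, fun {y} _ => by simpa [diag] using hF y⟩
  refine (FormalMultilinearSeries.radius_eq_top_of_summable_norm _ fun r => ?_).ge
  -- The factor `2e` is the polarization constant; `r + 1` keeps the radius positive when `r = 0`.
  refine Summable.of_nonneg_of_le (fun j => by positivity) (fun j => ?_)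
    (hs (2 * Real.exp 1 * (r + 1)) (by positivity))
  calc ‖B j‖ * (r : ℝ) ^ j ≤ ‖B j‖ * ((r : ℝ) + 1) ^ j := by gcongr; linarith
    _ ≤ (2 * Real.exp 1) ^ j * c j * ((r : ℝ) + 1) ^ j := by
      gcongr
      exact (hB j).norm_le (hc0 j) (hc j)
    _ = _ := by rw [mul_pow (2 * Real.exp 1)]; ring

/-- An entire function is the sum of its Taylor series. -/
theorem Entire.hasSum_dhat {f : E → ℂ} (hf : Entire f) (a x : E) :
    HasSum (fun n => (n.factorial : ℂ)⁻¹ * dhat n f a x) (f (a + x)) := by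
  -- On a complex line the Taylor series converges everywhere, although the power series of `f` on
  -- `E` may have finite radius of convergence.
  let g : ℂ → ℂ := fun t => f (a + t • x)
  have hcont : ContDiff ℂ ⊤ f := hf.contDiff
  have hg : Differentiable ℂ g := fun t =>
    (hf (a + t • x) (mem_univ _)).differentiableAt.comp t (by fun_prop)
  have hd : ∀ n, iteratedDeriv n g 0 = dhat n f a x := by
    intro n
    have h1 : g = (fun y => f (a + y)) ∘ (ContinuousLinearMap.toSpanSingleton ℂ x) := by
      ext t
      simp [g]
    have h2 : ContDiff ℂ ⊤ fun y => f (a + y) := hcont.comp (by fun_prop)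
    rw [iteratedDeriv_eq_iteratedFDeriv, h1,
      ContinuousLinearMap.iteratedFDeriv_comp_right (i := n) _ h2 0 (by simp)]
    simp [iteratedFDeriv_comp_add_left, dhat]
  have h := Complex.hasSum_taylorSeries_of_entire hg 0 1
  simpa [hd, g] using h

end PowerSeries

/-! ### Growth of the weights -/

section Weights

/-- The exponents `n/k` and `m/k` add up, and each base is at most `(n + m)/(ke)`. -/
theorem weight_mul_le (k : ℝ≥0∞) (n m : ℕ) : weight k n * weight k m ≤ weight k (n + m) := by
  unfold weight
  split_ifs with h
  · simp
  · set c := k.toReal * Real.exp 1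
    have hc : 0 ≤ c := by positivity
    have hk : 0 ≤ k.toReal := ENNReal.toReal_nonneg
    have e : ((n + m : ℕ) : ℝ) / k.toReal = n / k.toReal + m / k.toReal := by
      push_cast
      ring
    rw [e, Real.rpow_add_of_nonneg (by positivity) (by positivity) (by positivity)]
    gcongr <;> simp

theorem exists_pow_le_weight {k : ℝ≥0∞} (hk : k ≠ 0) :
    ∃ b : ℝ, 0 < b ∧ ∀ j, b ^ j ≤ weight k j := by
  by_cases h : k = ⊤
  · exact ⟨1, one_pos, fun j => by simp [weight, h]⟩
  · have hk' : 0 < k.toReal := ENNReal.toReal_pos hk h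
    have hc : 0 < k.toReal * Real.exp 1 := by positivity
    refine ⟨(1 / (k.toReal * Real.exp 1)) ^ (1 / k.toReal), by positivity, fun j => ?_⟩
    rw [weight, if_neg h, ← Real.rpow_natCast, ← Real.rpow_mul (by positivity),
      one_div_mul_eq_div]
    rcases Nat.eq_zero_or_pos j with rfl | hj
    · simp
    · have : (1 : ℝ) ≤ j := by exact_mod_cast hj
      gcongr

/-- Since `w(n) bᵐ ≤ w(n) w(m) ≤ w(n + m)`, the weight of degree `n` can be traded for that of
degree `n + m` at geometric cost, as translation and differentiation require. -/
theorem exists_weight_mul_pow_le {k : ℝ≥0∞} (hk : k ≠ 0) :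
    ∃ b : ℝ, 0 < b ∧ (∀ j, b ^ j ≤ weight k j) ∧
      ∀ n m, weight k n ≤ (b⁻¹) ^ m * weight k (n + m) := by
  obtain ⟨b, hb, h⟩ := exists_pow_le_weight hk
  refine ⟨b, hb, h, fun n m => ?_⟩
  have h1 := (mul_le_mul_of_nonneg_left (h m) (weight_nonneg k n)).trans (weight_mul_le k n m)
  rw [inv_pow, ← div_eq_inv_mul, le_div_iff₀ (by positivity)]
  exact h1

/-- From `nⁿ ≤ eⁿ n!` one gets `w(n) ≤ e^{n/k} (n!)^{1/k}`, so for finite `k` the terms are at most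
`Aⁿ / (n!)^s` with `s = 1 - 1/k`, positive exactly because `k > 1`. -/
theorem summable_pow_mul_weight_div_factorial {k : ℝ≥0∞} (hk : 1 < k) {R : ℝ} (hR : 0 < R) :
    Summable fun n : ℕ => R ^ n * weight k n / n.factorial := by
  by_cases h : k = ⊤
  · simpa [weight, h] using Real.summable_pow_div_factorial R
  have hk1 : 1 < k.toReal := by
    simpa using (ENNReal.toReal_lt_toReal ENNReal.one_ne_top h).2 hk
  have hk0 : 0 < k.toReal := by linarith
  set s : ℝ := 1 - 1 / k.toReal with hs
  have hs0 : 0 < s := by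
    rw [hs, sub_pos, div_lt_one hk0]
    exact hk1
  set A : ℝ := R * Real.exp (1 / k.toReal) with hA
  have hA0 : 0 < A := by positivity
  have hfac : ∀ n : ℕ, (0 : ℝ) < n.factorial := fun n => Nat.cast_pos.2 n.factorial_pos
  have hsum : Summable fun n : ℕ => A ^ n * ((n.factorial : ℝ) ^ s)⁻¹ := by
    refine summable_of_ratio_test_tendsto_lt_one (l := 0) one_pos
      (Eventually.of_forall fun n => ?_) ?_
    · have := Real.rpow_pos_of_pos (hfac n) s
      positivity
    · have h1 : Tendsto (fun n : ℕ => A * (((n + 1 : ℕ) : ℝ) ^ s)⁻¹) atTop (𝓝 (A * 0)) :=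
        (((tendsto_rpow_atTop hs0).comp
          (tendsto_natCast_atTop_atTop.comp (tendsto_add_atTop_nat 1))).inv_tendsto_atTop).const_mul A
      rw [mul_zero] at h1
      refine h1.congr fun n => ?_
      have h2 := Real.rpow_pos_of_pos (hfac n) s
      have h3 : (0 : ℝ) < ((n + 1 : ℕ) : ℝ) ^ s := by positivity
      rw [Real.norm_of_nonneg (by positivity), Real.norm_of_nonneg (by positivity),
        Nat.factorial_succ, Nat.cast_mul, Real.mul_rpow (by positivity) (by positivity), pow_succ]
      field_simp
  refine Summable.of_nonneg_of_le (fun n => ?_) (fun n => ?_) hsum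
  · have := weight_nonneg k n
    positivity
  · have h1 : weight k n ≤ Real.exp (1 / k.toReal) ^ n * (n.factorial : ℝ) ^ (1 / k.toReal) := by
      rw [weight, if_neg h]
      have h2 : (n : ℝ) / (k.toReal * Real.exp 1) ≤ n := by
        refine div_le_self (Nat.cast_nonneg n) ?_
        have := Real.add_one_le_exp (1 : ℝ)
        nlinarith
      have h4 : (n : ℝ) ^ n ≤ Real.exp n * n.factorial := by
        have := Real.pow_div_factorial_le_exp (n : ℝ) (Nat.cast_nonneg n) n
        rwa [div_le_iff₀ (hfac n)] at this
      calc ((n : ℝ) / (k.toReal * Real.exp 1)) ^ ((n : ℝ) / k.toReal)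
          ≤ (n : ℝ) ^ ((n : ℝ) / k.toReal) := by gcongr
        _ = ((n : ℝ) ^ n) ^ (1 / k.toReal) := by
          rw [← Real.rpow_natCast, ← Real.rpow_mul (by positivity), mul_one_div]
        _ ≤ (Real.exp n * n.factorial) ^ (1 / k.toReal) := by gcongr
        _ = _ := by
          rw [Real.mul_rpow (by positivity) (by positivity), ← Real.exp_mul, ← Real.exp_nat_mul]
    have h5 : (n.factorial : ℝ) ^ (1 / k.toReal) * (n.factorial : ℝ) ^ s = n.factorial := by
      rw [← Real.rpow_add (hfac n), hs, add_sub_cancel, Real.rpow_one]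
    have h6 := Real.rpow_pos_of_pos (hfac n) s
    rw [div_le_iff₀ (hfac n)]
    calc R ^ n * weight k n
        ≤ R ^ n * (Real.exp (1 / k.toReal) ^ n * (n.factorial : ℝ) ^ (1 / k.toReal)) := by gcongr
      _ = A ^ n * ((n.factorial : ℝ) ^ s)⁻¹ *
          ((n.factorial : ℝ) ^ (1 / k.toReal) * (n.factorial : ℝ) ^ s) := by
        rw [hA, mul_pow]
        field_simp
      _ = _ := by rw [h5]

end Weights

/-! ### Double series -/

section DoubleSeries

theorem hasSum_sum_antidiagonal {F : ℕ × ℕ → ℂ} {S : ℂ} (h : HasSum F S) :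
    HasSum (fun j => ∑ p ∈ Finset.HasAntidiagonal.antidiagonal j, F p) S := by
  have h1 := Finset.HasAntidiagonal.sigmaAntidiagonalEquivProd.hasSum_iff.2 h
  refine (h1.sigma fun j => ?_)
  exact Finset.hasSum _ _

/-- The `j`-th antidiagonal has `j + 1 ≤ 2 ^ j` points. The factor `2 ^ j` is later absorbed by
halving `ρ`. -/
theorem summable_comp_add {p : ℕ → ℝ} (hp : ∀ j, 0 ≤ p j) (h : Summable fun j => 2 ^ j * p j) :
    Summable (fun q : ℕ × ℕ => p (q.1 + q.2)) ∧
      ∑' q : ℕ × ℕ, p (q.1 + q.2) ≤ ∑' j, 2 ^ j * p j := by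
  have hle : ∀ j : ℕ, ((j : ℝ) + 1) * p j ≤ 2 ^ j * p j := fun j => by
    refine mul_le_mul_of_nonneg_right ?_ (hp j)
    exact_mod_cast Nat.lt_two_pow_self (n := j)
  have h1 : Summable fun j : ℕ => ((j : ℝ) + 1) * p j :=
    Summable.of_nonneg_of_le (fun j => mul_nonneg (by positivity) (hp j)) hle h
  let e : (Σ j : ℕ, Finset.HasAntidiagonal.antidiagonal j) ≃ ℕ × ℕ :=
    Finset.HasAntidiagonal.sigmaAntidiagonalEquivProd
  have he : ∀ x, (e x).1 + (e x).2 = x.1 := fun x =>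
    Finset.HasAntidiagonal.mem_antidiagonal.1 x.2.2
  have hin : ∀ j : ℕ, HasSum (fun _ : Finset.HasAntidiagonal.antidiagonal j => p j)
      (((j : ℝ) + 1) * p j) := fun j => by
    have := hasSum_fintype fun _ : Finset.HasAntidiagonal.antidiagonal j => p j
    rw [Finset.sum_const, Finset.card_univ, Fintype.card_coe, Finset.Nat.card_antidiagonal,
      nsmul_eq_mul] at this
    exact_mod_cast this
  have h2 : Summable fun x : (Σ j : ℕ, Finset.HasAntidiagonal.antidiagonal j) => p x.1 :=
    (summable_sigma_of_nonneg fun _ => hp _).2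
      ⟨fun j => (hin j).summable, h1.congr fun j => (hin j).tsum_eq.symm⟩
  have h3 : HasSum (fun q : ℕ × ℕ => p (q.1 + q.2)) (∑' j : ℕ, ((j : ℝ) + 1) * p j) := by
    rw [← e.hasSum_iff]
    have h4 := h2.hasSum
    rw [← (h4.sigma hin).tsum_eq] at h4
    exact h4.congr_fun fun x => congrArg p (he x)
  exact ⟨h3.summable, h3.tsum_eq.trans_le (h1.tsum_le_tsum hle h)⟩

theorem hasDerivAt_zero_of_hasSum_pow {c : ℕ → ℂ} {g : ℂ → ℂ}
    (h : ∀ t, HasSum (fun m => t ^ m * c m) (g t)) : HasDerivAt g (c 1) 0 := by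
  have h1 : HasFPowerSeriesAt g (FormalMultilinearSeries.ofScalars ℂ c) 0 := by
    rw [hasFPowerSeriesAt_iff]
    exact Eventually.of_forall fun t => by
      simpa [FormalMultilinearSeries.coeff_ofScalars] using h t
  simpa [FormalMultilinearSeries.coeff_ofScalars] using h1.hasDerivAt

end DoubleSeries

variable {E : Type*} [NormedAddCommGroup E] [NormedSpace ℂ E]

/-! ### Estimates in the spaces of a holomorphy type -/

namespace HolomorphyType

variable (Θ : HolomorphyType E)

/-- This is the derivative bound of order `0`: `d̂⁰P(x)` is the constant `P(x)`, whose `Θ`-norm is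
its modulus. -/
theorem exists_norm_apply_le : ∃ σ : ℝ, 1 ≤ σ ∧ ∀ (j : ℕ) (P : Θ.space j) (x : E),
    ‖(P : E → ℂ) x‖ ≤ σ ^ j * Θ.nrm j P * ‖x‖ ^ j := by
  obtain ⟨σ, hσ, h⟩ := Θ.deriv_bound
  refine ⟨σ, hσ, fun j P x => ?_⟩
  obtain ⟨h1, h2⟩ := h 0 j (Nat.zero_le j) x P
  have e : dhat 0 (P : E → ℂ) x = fun _ => (P : E → ℂ) x := by
    ext y
    simp [dhat]
  have h3 : ∀ (g : E → ℂ) (hg : g ∈ Θ.space 0) (c : ℂ), g = (fun _ => c) →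
      Θ.nrm 0 ⟨g, hg⟩ = ‖c‖ := by
    rintro g hg c rfl
    exact Θ.nrm_zero c hg
  simp only [Nat.factorial_zero, Nat.cast_one, inv_one, one_smul, Nat.sub_zero] at h2
  rwa [h3 _ h1 _ e] at h2

theorem exists_nrm_choose_smul_partialDiag_le : ∃ σ : ℝ, 1 ≤ σ ∧ ∀ (n j : ℕ) (hn : n ≤ j)
    (B : ContinuousMultilinearMap ℂ (fun _ : Fin j => E) ℂ) (hB : IsSymm B)
    (hP : diag B ∈ Θ.space j) (y : E),
    Θ.nrm n ((j.choose n : ℂ) • ⟨partialDiag B n y, partialDiag_mem_space Θ hn hB hP y⟩) ≤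
      σ ^ j * Θ.nrm j ⟨diag B, hP⟩ * ‖y‖ ^ (j - n) := by
  obtain ⟨σ, hσ, h⟩ := Θ.deriv_bound
  refine ⟨σ, hσ, fun n j hn B hB hP y => ?_⟩
  obtain ⟨h1, h2⟩ := h n j hn y ⟨diag B, hP⟩
  refine le_of_eq_of_le (congrArg _ (Subtype.ext ?_)) h2
  have h3 : (n.factorial : ℂ) ≠ 0 := Nat.cast_ne_zero.2 n.factorial_ne_zero
  change (j.choose n : ℂ) • partialDiag B n y = (n.factorial : ℂ)⁻¹ • dhat n (diag B) y
  rw [dhat_diag_eq B hB n hn y, smul_smul, Nat.descFactorial_eq_factorial_mul_choose]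
  congr 1
  push_cast
  field_simp

variable {Θ}

/-- Absolutely convergent series in `P_Θ(ⁿE)` converge. -/
theorem exists_tendsto_of_summable_nrm {n : ℕ} {u : ℕ → Θ.space n}
    (hu : Summable fun m => Θ.nrm n (u m)) : ∃ P : Θ.space n,
      Tendsto (fun N => Θ.nrm n (∑ m ∈ Finset.range N, u m - P)) atTop (𝓝 0) ∧
      Θ.nrm n P ≤ ∑' m, Θ.nrm n (u m) := by
  have hcau := hu.hasSum.tendsto_sum_nat.cauchySeq
  have hdiff : ∀ p q, p ≤ q → Θ.nrm n (∑ m ∈ Finset.range q, u m - ∑ m ∈ Finset.range p, u m) ≤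
      ∑ m ∈ Finset.range q, Θ.nrm n (u m) - ∑ m ∈ Finset.range p, Θ.nrm n (u m) := by
    intro p q hpq
    rw [← Finset.sum_Ico_eq_sub _ hpq, ← Finset.sum_Ico_eq_sub _ hpq]
    exact Finset.le_sum_of_subadditive _ (map_zero _).le (map_add_le_add _) _ _
  obtain ⟨P, hP⟩ := Θ.complete n (fun N => ∑ m ∈ Finset.range N, u m) fun ε hε => by
    obtain ⟨N, hN⟩ := Metric.cauchySeq_iff.1 hcau ε hε
    refine ⟨N, fun p hp q hq => ?_⟩
    rcases le_total p q with hpq | hpq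
    · rw [map_sub_rev]
      refine (hdiff p q hpq).trans_lt ((le_abs_self _).trans_lt ?_)
      exact hN q hq p hp
    · exact (hdiff q p hpq).trans_lt ((le_abs_self _).trans_lt (hN p hp q hq))
  refine ⟨P, hP, ?_⟩
  have h1 : Tendsto (fun N => Θ.nrm n (∑ m ∈ Finset.range N, u m - P) + ∑' m, Θ.nrm n (u m))
      atTop (𝓝 (0 + ∑' m, Θ.nrm n (u m))) := hP.add_const _
  rw [zero_add] at h1
  refine ge_of_tendsto' h1 fun N => ?_
  have h2 : Θ.nrm n P ≤ Θ.nrm n (∑ m ∈ Finset.range N, u m - P) +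
      Θ.nrm n (∑ m ∈ Finset.range N, u m) := by
    have := map_add_le_add (Θ.nrm n) (P - ∑ m ∈ Finset.range N, u m) (∑ m ∈ Finset.range N, u m)
    rwa [sub_add_cancel, map_sub_rev] at this
  refine h2.trans (add_le_add_right ?_ _)
  exact (Finset.le_sum_of_subadditive _ (map_zero _).le (map_add_le_add _) _ _).trans
    (hu.sum_le_tsum _ fun _ _ => apply_nonneg _ _)

end HolomorphyType

/-! ### Topology, functionals and Taylor series in the exponential space -/

namespace ExpSpace

variable {Θ : HolomorphyType E} {k : ℝ≥0∞}

instance : IsTopologicalAddGroup (ExpSpace Θ k) := withSeminorms.topologicalAddGroup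

instance : ContinuousSMul ℂ (ExpSpace Θ k) := withSeminorms.continuousSMul

@[ext]
theorem ext {f g : ExpSpace Θ k} (h : ∀ x, f x = g x) : f = g := Subtype.ext (funext h)

@[simp]
theorem add_apply (f g : ExpSpace Θ k) (x : E) : (f + g) x = f x + g x := rfl

@[simp]
theorem smul_apply (c : ℂ) (f : ExpSpace Θ k) (x : E) : (c • f) x = c * f x := rfl

theorem expNorm_apply (ρ : Set.Ioi (0 : ℝ)) (f : ExpSpace Θ k) :
    expNorm Θ k ρ f = ∑' j : ℕ, ((ρ : ℝ) ^ j)⁻¹ * weight k j * Θ.nrm j (taylor j f) := rfl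

theorem term_nonneg (ρ : Set.Ioi (0 : ℝ)) (j : ℕ) (P : Θ.space j) :
    0 ≤ ((ρ : ℝ) ^ j)⁻¹ * weight k j * Θ.nrm j P := by
  have := weight_nonneg k j
  have := ρ.2.out
  positivity

theorem expNorm_anti {ρ ρ' : Set.Ioi (0 : ℝ)} (h : ρ ≤ ρ') : expNorm Θ k ρ' ≤ expNorm Θ k ρ := by
  intro f
  refine (f.summable_taylor ρ').tsum_le_tsum (fun j => ?_) (f.summable_taylor ρ)
  have := weight_nonneg k j
  have := ρ.2.out
  have : (ρ : ℝ) ≤ ρ' := h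
  gcongr

/-- A polynomial in `P_Θ(ⁿE)` as an element of `Exp^k_{Θ,0}(E)`. -/
noncomputable def ofSpace (Θ : HolomorphyType E) (k : ℝ≥0∞) (n : ℕ) :
    Θ.space n →ₗ[ℂ] ExpSpace Θ k where
  toFun P := ⟨P, mem_expSubmodule_of_mem_space Θ k P.2⟩
  map_add' _ _ := rfl
  map_smul' _ _ := rfl

@[simp]
theorem ofSpace_apply {n : ℕ} (P : Θ.space n) (x : E) : ofSpace Θ k n P x = (P : E → ℂ) x := rfl

theorem taylor_ofSpace {n : ℕ} (P : Θ.space n) : taylor n (ofSpace Θ k n P) = P := by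
  refine Subtype.ext ?_
  change (n.factorial : ℂ)⁻¹ • dhat n (P : E → ℂ) 0 = P
  obtain ⟨B, hB⟩ := Θ.space_le n P.2
  have : (n.factorial : ℂ) ≠ 0 := Nat.cast_ne_zero.2 n.factorial_ne_zero
  rw [hB, dhat_diag, if_pos rfl, smul_smul, inv_mul_cancel₀ this, one_smul]

theorem taylor_ofSpace_of_ne {n j : ℕ} (h : j ≠ n) (P : Θ.space n) :
    taylor j (ofSpace Θ k n P) = 0 := by
  refine Subtype.ext ?_
  change (j.factorial : ℂ)⁻¹ • dhat j (P : E → ℂ) 0 = 0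
  obtain ⟨B, hB⟩ := Θ.space_le n P.2
  rw [hB, dhat_diag, if_neg h, smul_zero]

theorem expNorm_ofSpace (ρ : Set.Ioi (0 : ℝ)) {n : ℕ} (P : Θ.space n) :
    expNorm Θ k ρ (ofSpace Θ k n P) = ((ρ : ℝ) ^ n)⁻¹ * weight k n * Θ.nrm n P := by
  rw [expNorm_apply, tsum_eq_single n fun j hj => by rw [taylor_ofSpace_of_ne hj]; simp,
    taylor_ofSpace]

/-- Continuous functionals are bounded with respect to one of the norms. -/
theorem exists_bound (T : ExpSpace Θ k →L[ℂ] ℂ) :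
    ∃ (C : ℝ) (ρ : Set.Ioi (0 : ℝ)), 0 < C ∧ ∀ f, ‖T f‖ ≤ C * expNorm Θ k ρ f := by
  obtain ⟨s, C, hC, h⟩ := Seminorm.bound_of_continuous withSeminorms
    ((normSeminorm ℂ ℂ).comp T.toLinearMap) (continuous_norm.comp T.continuous)
  -- The norms decrease in `ρ`, so the smallest of finitely many indices dominates the others.
  obtain ⟨ρ, hρ⟩ : ∃ ρ : Set.Ioi (0 : ℝ), ∀ i ∈ s, ρ ≤ i := by
    rcases s.eq_empty_or_nonempty with rfl | hs
    · exact ⟨⟨1, Set.mem_Ioi.2 one_pos⟩, by simp⟩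
    · exact ⟨s.min' hs, fun i hi => s.min'_le i hi⟩
  refine ⟨C, ρ, NNReal.coe_pos.2 (pos_iff_ne_zero.2 hC), fun f => (h f).trans ?_⟩
  have h1 : s.sup (expNorm Θ k) ≤ expNorm Θ k ρ := Finset.sup_le fun i hi => expNorm_anti (hρ i hi)
  exact mul_le_mul_of_nonneg_left (h1 f) C.2

theorem continuous_of_bound {T : ExpSpace Θ k →ₗ[ℂ] ℂ} {C : ℝ} (hC : 0 ≤ C)
    {ρ : Set.Ioi (0 : ℝ)} (h : ∀ f, ‖T f‖ ≤ C * expNorm Θ k ρ f) : Continuous T :=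
  WithSeminorms.continuous_normedSpace_rng ℂ withSeminorms T
    ⟨{ρ}, ⟨C, hC⟩, fun f => by
      rw [Finset.sup_singleton]
      exact h f⟩

theorem hasSum_taylor_apply (f : ExpSpace Θ k) (x : E) :
    HasSum (fun n => (taylor n f : E → ℂ) x) (f x) := by
  have h := f.entire.hasSum_dhat 0 x
  rw [zero_add] at h
  exact h

/-- The Taylor series of `f` converges to `f` in `Exp^k_{Θ,0}(E)`. -/
theorem tendsto_sum_taylor (f : ExpSpace Θ k) :
    Tendsto (fun N => ∑ n ∈ Finset.range N, ofSpace Θ k n (taylor n f)) atTop (𝓝 f) := by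
  rw [withSeminorms.tendsto_nhds]
  intro ρ ε hε
  -- The distance to the `N`-th partial sum is exactly the tail of the series defining the norm of
  -- `f`.
  have hN : ∀ N, expNorm Θ k ρ (∑ n ∈ Finset.range N, ofSpace Θ k n (taylor n f) - f) =
      ∑' j, ((ρ : ℝ) ^ (j + N))⁻¹ * weight k (j + N) * Θ.nrm (j + N) (taylor (j + N) f) := by
    intro N
    have ht : ∀ j, taylor j (f - ∑ n ∈ Finset.range N, ofSpace Θ k n (taylor n f)) =
        if j < N then 0 else taylor j f := by
      intro j
      rw [map_sub, map_sum]
      split_ifs with hj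
      · rw [Finset.sum_eq_single_of_mem j (Finset.mem_range.2 hj) fun n _ hn =>
          taylor_ofSpace_of_ne hn.symm _, taylor_ofSpace, sub_self]
      · rw [Finset.sum_eq_zero fun n hn => taylor_ofSpace_of_ne (by
          have := Finset.mem_range.1 hn
          omega) _, sub_zero]
    rw [map_sub_rev, expNorm_apply, ← Summable.sum_add_tsum_nat_add N (summable_taylor _ ρ),
      Finset.sum_eq_zero fun j hj => by
        rw [ht, if_pos (Finset.mem_range.1 hj), map_zero, mul_zero], zero_add]
    exact tsum_congr fun j => by rw [ht, if_neg (by omega)]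
  simp_rw [hN]
  have h0 := tendsto_sum_nat_add fun j : ℕ =>
    ((ρ : ℝ) ^ j)⁻¹ * weight k j * Θ.nrm j (taylor j f)
  exact h0.eventually_lt_const hε

theorem norm_ofSpace_le {T : ExpSpace Θ k →L[ℂ] ℂ} {C : ℝ} {ρ : Set.Ioi (0 : ℝ)}
    (h : ∀ f, ‖T f‖ ≤ C * expNorm Θ k ρ f) {n : ℕ} (P : Θ.space n) :
    ‖T (ofSpace Θ k n P)‖ ≤ C * (((ρ : ℝ) ^ n)⁻¹ * weight k n * Θ.nrm n P) := by
  rw [← expNorm_ofSpace]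
  exact h _

theorem hasSum_taylor (T : ExpSpace Θ k →L[ℂ] ℂ) (f : ExpSpace Θ k) :
    HasSum (fun n => T (ofSpace Θ k n (taylor n f))) (T f) := by
  obtain ⟨C, ρ, hC, h⟩ := exists_bound T
  have hs : Summable fun n => T (ofSpace Θ k n (taylor n f)) :=
    Summable.of_norm_bounded ((f.summable_taylor ρ).mul_left C) fun n => norm_ofSpace_le h _
  have h1 := (T.continuous.tendsto f).comp (tendsto_sum_taylor f)
  refine (tendsto_nhds_unique hs.hasSum.tendsto_sum_nat (h1.congr fun N => ?_)) ▸ hs.hasSum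
  simp

/-- It explains the choice `ρ = b / R` below: the norm with this index controls the plain power
series of radius `R`. -/
theorem ratio_pow_mul_le {b R : ℝ} (hb : 0 < b) (hR : 0 < R)
    (h : ∀ j, b ^ j ≤ weight k j) (j : ℕ) :
    R ^ j ≤ ((b / R) ^ j)⁻¹ * weight k j := by
  rw [div_pow, inv_div, div_mul_eq_mul_div, le_div_iff₀ (by positivity)]
  exact mul_le_mul_of_nonneg_left (h j) (by positivity)

/-- A sequence of polynomials of small `Θ`-norms is the sequence of Taylor coefficients of an
element of `Exp^k_{Θ,0}(E)`. -/
theorem exists_of_summable (hk : k ≠ 0) (Q : ∀ n, Θ.space n)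
    (hQ : ∀ ρ : Set.Ioi (0 : ℝ), Summable fun n => ((ρ : ℝ) ^ n)⁻¹ * weight k n * Θ.nrm n (Q n)) :
    ∃ g : ExpSpace Θ k, ∀ n, taylor n g = Q n := by
  obtain ⟨σ, hσ, hev⟩ := Θ.exists_norm_apply_le
  obtain ⟨b, hb, hw⟩ := exists_pow_le_weight hk
  choose B hB hBQ using fun n => exists_isSymm_diag_eq (Θ.space_le n (Q n).2)
  have hs : ∀ R : ℝ, 0 < R → Summable fun j => R ^ j * (σ ^ j * Θ.nrm j (Q j)) := by
    intro R hR
    have hRσ : 0 < R * σ := by positivity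
    refine Summable.of_nonneg_of_le (fun j => by positivity) (fun j => ?_)
      (hQ ⟨b / (R * σ), by simp only [Set.mem_Ioi]; positivity⟩)
    rw [← mul_assoc, ← mul_pow]
    exact mul_le_mul_of_nonneg_right (ratio_pow_mul_le hb hRσ hw j) (apply_nonneg _ _)
  have hc : ∀ j x, ‖diag (B j) x‖ ≤ σ ^ j * Θ.nrm j (Q j) * ‖x‖ ^ j := fun j x => by
    rw [hBQ j]
    exact hev j (Q j) x
  have hF : ∀ x, HasSum (fun j => diag (B j) x) (∑' j, diag (B j) x) := fun x => by
    refine (Summable.of_norm_bounded (hs (‖x‖ + 1) (by positivity)) fun j => ?_).hasSum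
    refine (hc j x).trans ?_
    rw [mul_comm]
    gcongr
    linarith
  have hp := hasFPowerSeriesOnBall_of_hasSum_diag hB hc (fun j => by positivity) hs hF
  have hd : ∀ n, dhat n (fun x => ∑' j, diag (B j) x) 0 = (n.factorial : ℂ) • (Q n : E → ℂ) := by
    intro n
    ext x
    rw [← hBQ n]
    simpa [diag, dhat] using (hp.factorial_smul x n).symm
  have hmem : ∀ n, dhat n (fun x => ∑' j, diag (B j) x) 0 ∈ Θ.space n := fun n => by
    rw [hd]
    exact (Θ.space n).smul_mem _ (Q n).2
  have ht : ∀ n, (n.factorial : ℂ)⁻¹ •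
      (⟨dhat n (fun x => ∑' j, diag (B j) x) 0, hmem n⟩ : Θ.space n) = Q n := fun n => by
    have : (n.factorial : ℂ) ≠ 0 := Nat.cast_ne_zero.2 n.factorial_ne_zero
    refine Subtype.ext ?_
    change (n.factorial : ℂ)⁻¹ • dhat n (fun x => ∑' j, diag (B j) x) 0 = _
    rw [hd, smul_smul, inv_mul_cancel₀ this, one_smul]
  have hent : Entire fun x => ∑' j, diag (B j) x := by
    have := hp.analyticOnNhd
    rwa [Metric.eball_top] at this
  exact ⟨⟨fun x => ∑' j, diag (B j) x, (Submodule.mem_iInf _).2 fun ρ =>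
    ⟨hent, hmem, (hQ ρ).congr fun n => by rw [ht]⟩⟩, ht⟩

/-- Evaluation at a point is a continuous functional. -/
theorem exists_eval (Θ : HolomorphyType E) (hk : k ≠ 0) (x : E) :
    ∃ T : ExpSpace Θ k →L[ℂ] ℂ, ∀ f : ExpSpace Θ k, T f = f x := by
  obtain ⟨σ, hσ, hev⟩ := Θ.exists_norm_apply_le
  obtain ⟨b, hb, hw⟩ := exists_pow_le_weight hk
  let l : ExpSpace Θ k →ₗ[ℂ] ℂ :=
    { toFun := fun f => f x
      map_add' := fun _ _ => rfl
      map_smul' := fun _ _ => rfl }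
  have hR : 0 < σ * (‖x‖ + 1) := by positivity
  refine ⟨⟨l, continuous_of_bound (C := 1)
    (ρ := ⟨b / (σ * (‖x‖ + 1)), by simp only [Set.mem_Ioi]; positivity⟩) zero_le_one
      fun f => ?_⟩, fun f => rfl⟩
  rw [one_mul, expNorm_apply]
  change ‖f x‖ ≤ _
  rw [← (hasSum_taylor_apply f x).tsum_eq]
  refine tsum_of_norm_bounded (summable_taylor f _).hasSum fun n => (hev n _ x).trans ?_
  · calc σ ^ n * Θ.nrm n (taylor n f) * ‖x‖ ^ n
        ≤ σ ^ n * Θ.nrm n (taylor n f) * (‖x‖ + 1) ^ n := by gcongr; linarith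
      _ = (σ * (‖x‖ + 1)) ^ n * Θ.nrm n (taylor n f) := by rw [mul_pow]; ring
      _ ≤ _ := mul_le_mul_of_nonneg_right (ratio_pow_mul_le hb hR hw n) (apply_nonneg _ _)

/-- A double series of polynomials of small `Θ`-norms converges in `Exp^k_{Θ,0}(E)`. -/
theorem exists_hasSum_of_summable (hk : k ≠ 0) (Q : ∀ n, ℕ → Θ.space n)
    (hQ : ∀ ρ : Set.Ioi (0 : ℝ), Summable fun p : ℕ × ℕ =>
      ((ρ : ℝ) ^ p.1)⁻¹ * weight k p.1 * Θ.nrm p.1 (Q p.1 p.2)) :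
    ∃ g : ExpSpace Θ k,
      (∀ T : ExpSpace Θ k →L[ℂ] ℂ,
        HasSum (fun p : ℕ × ℕ => T (ofSpace Θ k p.1 (Q p.1 p.2))) (T g)) ∧
      ∀ ρ : Set.Ioi (0 : ℝ), expNorm Θ k ρ g ≤
        ∑' p : ℕ × ℕ, ((ρ : ℝ) ^ p.1)⁻¹ * weight k p.1 * Θ.nrm p.1 (Q p.1 p.2) := by
  obtain ⟨b, hb, hw⟩ := exists_pow_le_weight hk
  have hpos : ∀ n, 0 < weight k n := fun n => (pow_pos hb n).trans_le (hw n)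
  have hrow : ∀ n, Summable fun m => Θ.nrm n (Q n m) := fun n => by
    have h := (hQ ⟨1, Set.mem_Ioi.2 one_pos⟩).prod_factor n
    simp only [one_pow, inv_one, one_mul] at h
    exact (summable_mul_left_iff (hpos n).ne').1 h
  -- Each row is summed in the Banach space `P_Θ(ⁿE)`; the row sums `P n` become the Taylor
  -- coefficients of `g`.
  choose P hP hPn using fun n => HolomorphyType.exists_tendsto_of_summable_nrm (hrow n)
  have hle : ∀ (ρ : Set.Ioi (0 : ℝ)) n, ((ρ : ℝ) ^ n)⁻¹ * weight k n * Θ.nrm n (P n) ≤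
      ∑' m, ((ρ : ℝ) ^ n)⁻¹ * weight k n * Θ.nrm n (Q n m) := fun ρ n => by
    have := hpos n
    have := ρ.2.out
    rw [tsum_mul_left]
    exact mul_le_mul_of_nonneg_left (hPn n) (by positivity)
  have hsum : ∀ ρ : Set.Ioi (0 : ℝ),
      Summable fun n => ((ρ : ℝ) ^ n)⁻¹ * weight k n * Θ.nrm n (P n) := fun ρ =>
    Summable.of_nonneg_of_le (fun n => term_nonneg ρ n _) (hle ρ) (hQ ρ).prod
  obtain ⟨g, hg⟩ := exists_of_summable hk P hsum
  refine ⟨g, fun T => ?_, fun ρ => ?_⟩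
  · obtain ⟨C, ρ, hC, h⟩ := exists_bound T
    have hs : Summable fun p : ℕ × ℕ => T (ofSpace Θ k p.1 (Q p.1 p.2)) :=
      Summable.of_norm_bounded ((hQ ρ).mul_left C) fun p => norm_ofSpace_le h _
    have h1 : ∀ n, HasSum (fun m => T (ofSpace Θ k n (Q n m))) (T (ofSpace Θ k n (P n))) := by
      intro n
      have hsn := hs.prod_factor n
      have h2 : Tendsto (fun N => ∑ m ∈ Finset.range N, T (ofSpace Θ k n (Q n m)) -
          T (ofSpace Θ k n (P n))) atTop (𝓝 0) := by
        refine squeeze_zero_norm (a := fun N => C * (((ρ : ℝ) ^ n)⁻¹ * weight k n *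
          Θ.nrm n (∑ m ∈ Finset.range N, Q n m - P n))) (fun N => ?_) ?_
        · rw [← map_sum, ← map_sum, ← map_sub, ← map_sub]
          exact norm_ofSpace_le h _
        · simpa using ((hP n).const_mul (((ρ : ℝ) ^ n)⁻¹ * weight k n)).const_mul C
      have h3 := hsn.hasSum.tendsto_sum_nat
      have h4 := tendsto_nhds_unique h3 (tendsto_sub_nhds_zero_iff.1 h2)
      rw [← h4]
      exact hsn.hasSum
    have h5 := hs.hasSum.prod_fiberwise h1
    have h6 := hasSum_taylor T g
    simp only [hg] at h6
    rw [h6.unique h5]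
    exact hs.hasSum
  · rw [expNorm_apply, (hQ ρ).tsum_prod]
    simp only [hg]
    exact (hsum ρ).tsum_le_tsum (hle ρ) (hQ ρ).prod

end ExpSpace

/-! ### Translates, derivatives and convolution -/

namespace ExpSpace

variable {Θ : HolomorphyType E} {k : ℝ≥0∞}

theorem exists_form (f : ExpSpace Θ k) (j : ℕ) :
    ∃ B : ContinuousMultilinearMap ℂ (fun _ : Fin j => E) ℂ, IsSymm B ∧
      diag B = (taylor j f : E → ℂ) :=
  exists_isSymm_diag_eq (Θ.space_le j (taylor j f).2)

/-- The symmetric `j`-linear form of the `j`-th Taylor coefficient of `f`. -/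
noncomputable def form (f : ExpSpace Θ k) (j : ℕ) :
    ContinuousMultilinearMap ℂ (fun _ : Fin j => E) ℂ := (f.exists_form j).choose

theorem isSymm_form (f : ExpSpace Θ k) (j : ℕ) : IsSymm (f.form j) :=
  (f.exists_form j).choose_spec.1

theorem diag_form (f : ExpSpace Θ k) (j : ℕ) : diag (f.form j) = (taylor j f : E → ℂ) :=
  (f.exists_form j).choose_spec.2

theorem diag_form_mem (f : ExpSpace Θ k) (j : ℕ) : diag (f.form j) ∈ Θ.space j :=
  f.diag_form j ▸ (taylor j f).2

theorem mk_diag_form (f : ExpSpace Θ k) (j : ℕ) :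
    (⟨diag (f.form j), f.diag_form_mem j⟩ : Θ.space j) = taylor j f := Subtype.ext (f.diag_form j)

/-- The polynomial `x ↦ B(xⁿ, y^{j-n})` for the symmetric form `B` of the `j`-th Taylor coefficient
of `f`, as an element of `Exp^k_{Θ,0}(E)`; it is `0` for `n > j`. -/
noncomputable def part (f : ExpSpace Θ k) (j n : ℕ) (y : E) : ExpSpace Θ k :=
  if h : n ≤ j then partialExp Θ k h (f.isSymm_form j) (f.diag_form_mem j) y else 0

theorem part_of_le (f : ExpSpace Θ k) {j n : ℕ} (h : n ≤ j) (y : E) :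
    f.part j n y = partialExp Θ k h (f.isSymm_form j) (f.diag_form_mem j) y := dif_pos h

theorem part_apply (f : ExpSpace Θ k) {j n : ℕ} (h : n ≤ j) (y x : E) :
    f.part j n y x = partialDiag (f.form j) n y x := by
  rw [part_of_le f h]
  rfl

theorem part_smul (f : ExpSpace Θ k) {j n : ℕ} (h : n ≤ j) (t : ℂ) (y : E) :
    f.part j n (t • y) = t ^ (j - n) • f.part j n y := by
  ext x
  rw [smul_apply, part_apply f h, part_apply f h, partialDiag_smul h]

theorem summable_two_pow_mul (f : ExpSpace Θ k) {R : ℝ} (hR : 0 < R) :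
    Summable fun j : ℕ => 2 ^ j * (R ^ j * weight k j * Θ.nrm j (taylor j f)) := by
  refine (f.summable_taylor ⟨(2 * R)⁻¹, by simp only [Set.mem_Ioi]; positivity⟩).congr fun j => ?_
  rw [inv_pow, inv_inv, mul_pow]
  ring

/-- The translates of `f`, with their Taylor expansions. -/
theorem exists_translate (hk : k ≠ 0) (f : ExpSpace Θ k) (x : E) :
    ∃ g : ExpSpace Θ k, (∀ z, g z = f (z + x)) ∧ ∀ T : ExpSpace Θ k →L[ℂ] ℂ,
      HasSum (fun p : ℕ × ℕ => ((p.1 + p.2).choose p.1 : ℂ) * T (f.part (p.1 + p.2) p.1 x))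
        (T g) := by
  obtain ⟨σ, hσ, hpd⟩ := Θ.exists_nrm_choose_smul_partialDiag_le
  obtain ⟨b, hb, -, hw⟩ := exists_weight_mul_pow_le hk
  have hQn : ∀ n m, Θ.nrm n (((n + m).choose n : ℂ) • ⟨partialDiag (f.form (n + m)) n x,
      partialDiag_mem_space Θ (Nat.le_add_right n m) (f.isSymm_form _) (f.diag_form_mem _) x⟩) ≤
      σ ^ (n + m) * Θ.nrm (n + m) (taylor (n + m) f) * ‖x‖ ^ m := fun n m => by
    have := hpd n (n + m) (Nat.le_add_right n m) _ (f.isSymm_form _) (f.diag_form_mem _) x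
    rwa [mk_diag_form, Nat.add_sub_cancel_left] at this
  obtain ⟨g, hg, -⟩ := exists_hasSum_of_summable hk
    (fun n m => ((n + m).choose n : ℂ) • (⟨partialDiag (f.form (n + m)) n x,
      partialDiag_mem_space Θ (Nat.le_add_right n m) (f.isSymm_form _) (f.diag_form_mem _) x⟩ :
      Θ.space n)) fun ρ => by
    have hρ := ρ.2.out
    -- Here `σ ^ (n + m)` comes from the holomorphy type, `ρ⁻¹ ^ n` from the norm, and `(b⁻¹ * ‖x‖)
    -- ^ m` from the fixed entries together with the shift of the weight; `ρ⁻¹` and `b⁻¹ * ‖x‖` are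
    -- both at most their sum.
    set R : ℝ := σ * ((ρ : ℝ)⁻¹ + b⁻¹ * ‖x‖) with hRdef
    have hR : 0 < R := by positivity
    refine Summable.of_nonneg_of_le (fun p => term_nonneg ρ p.1 _) (fun p => ?_)
      (summable_comp_add (fun j => ?_) (f.summable_two_pow_mul hR)).1
    · obtain ⟨n, m⟩ := p
      have h1 := weight_nonneg k n
      have h2 := weight_nonneg k (n + m)
      calc _ ≤ ((ρ : ℝ) ^ n)⁻¹ * (b⁻¹ ^ m * weight k (n + m)) *
            (σ ^ (n + m) * Θ.nrm (n + m) (taylor (n + m) f) * ‖x‖ ^ m) := by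
            gcongr
            · exact hw n m
            · exact hQn n m
        _ = (σ ^ (n + m) * ((ρ : ℝ)⁻¹ ^ n * (b⁻¹ * ‖x‖) ^ m)) * weight k (n + m) *
            Θ.nrm (n + m) (taylor (n + m) f) := by
          rw [mul_pow b⁻¹, inv_pow (ρ : ℝ)]
          ring
        _ ≤ R ^ (n + m) * weight k (n + m) * Θ.nrm (n + m) (taylor (n + m) f) := by
          rw [hRdef, mul_pow σ, pow_add ((ρ : ℝ)⁻¹ + b⁻¹ * ‖x‖)]
          have h3 : (ρ : ℝ)⁻¹ ≤ (ρ : ℝ)⁻¹ + b⁻¹ * ‖x‖ := le_add_of_nonneg_right (by positivity)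
          have h4 : b⁻¹ * ‖x‖ ≤ (ρ : ℝ)⁻¹ + b⁻¹ * ‖x‖ := le_add_of_nonneg_left (by positivity)
          gcongr
    · have := weight_nonneg k j
      positivity
  have hg' : ∀ T : ExpSpace Θ k →L[ℂ] ℂ,
      HasSum (fun p : ℕ × ℕ => ((p.1 + p.2).choose p.1 : ℂ) * T (f.part (p.1 + p.2) p.1 x))
        (T g) := fun T => by
    refine (hg T).congr_fun fun p => ?_
    rw [part_of_le f (Nat.le_add_right p.1 p.2), map_smul, map_smul, smul_eq_mul]
    rfl
  refine ⟨g, fun z => ?_, hg'⟩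
  obtain ⟨δ, hδ⟩ := exists_eval Θ hk z
  have h1 := hasSum_sum_antidiagonal (hg' δ)
  -- Testing on `δ_z` identifies `g`: along antidiagonals the series is the binomial expansion of `f
  -- (z + x)`.
  rw [hδ] at h1
  refine h1.unique ((hasSum_taylor_apply f (z + x)).congr_fun fun j => ?_)
  rw [← diag_form, (f.isSymm_form j).diag_add]
  refine Finset.sum_congr rfl fun p hp => ?_
  obtain rfl := Finset.HasAntidiagonal.mem_antidiagonal.1 hp
  rw [hδ, part_apply f (Nat.le_add_right _ _)]

/-- The derivatives `df(·)a`, with their Taylor expansions. -/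
theorem exists_fderiv (hk : k ≠ 0) (f : ExpSpace Θ k) (a : E) :
    ∃ g : ExpSpace Θ k, (∀ z, g z = fderiv ℂ f z a) ∧
      ∀ (T : ExpSpace Θ k →L[ℂ] ℂ) (h : ℂ → ExpSpace Θ k), (∀ t z, h t z = f (z + t • a)) →
        HasDerivAt (fun t => T (h t)) (T g) 0 := by
  obtain ⟨σ, hσ, hpd⟩ := Θ.exists_nrm_choose_smul_partialDiag_le
  obtain ⟨b, hb, -, hw⟩ := exists_weight_mul_pow_le hk
  let Q : ∀ n, Θ.space n := fun n =>
    ((n + 1).choose n : ℂ) • (⟨partialDiag (f.form (n + 1)) n a,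
      partialDiag_mem_space Θ (Nat.le_add_right n 1) (f.isSymm_form _) (f.diag_form_mem _) a⟩ :
      Θ.space n)
  have hQn : ∀ n, Θ.nrm n (Q n) ≤
      σ ^ (n + 1) * Θ.nrm (n + 1) (taylor (n + 1) f) * ‖a‖ := fun n => by
    have := hpd n (n + 1) (Nat.le_add_right n 1) _ (f.isSymm_form _) (f.diag_form_mem _) a
    rwa [mk_diag_form, Nat.add_sub_cancel_left, pow_one] at this
  obtain ⟨g, hg⟩ := exists_of_summable hk Q fun ρ => by
    have hρ := ρ.2.out
    have hs := (summable_nat_add_iff 1).2 (f.summable_taylor ⟨ρ / σ, by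
      simp only [Set.mem_Ioi]; positivity⟩)
    refine Summable.of_nonneg_of_le (fun n => term_nonneg ρ n _) (fun n => ?_)
      (hs.mul_left (b⁻¹ * ρ * ‖a‖))
    have h1 := weight_nonneg k n
    have h2 := weight_nonneg k (n + 1)
    calc _ ≤ ((ρ : ℝ) ^ n)⁻¹ * (b⁻¹ ^ 1 * weight k (n + 1)) *
          (σ ^ (n + 1) * Θ.nrm (n + 1) (taylor (n + 1) f) * ‖a‖) := by
          gcongr
          · exact hw n 1
          · exact hQn n
      _ = _ := by
        rw [div_pow, pow_succ (ρ : ℝ)]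
        field_simp
  have hgT : ∀ T : ExpSpace Θ k →L[ℂ] ℂ,
      HasSum (fun n => ((n + 1).choose n : ℂ) * T (f.part (n + 1) n a)) (T g) := fun T => by
    refine (hasSum_taylor T g).congr_fun fun n => ?_
    rw [hg, part_of_le f (Nat.le_add_right n 1), map_smul, map_smul, smul_eq_mul]
    rfl
  have hderiv : ∀ (T : ExpSpace Θ k →L[ℂ] ℂ) (h : ℂ → ExpSpace Θ k),
      (∀ t z, h t z = f (z + t • a)) → HasDerivAt (fun t => T (h t)) (T g) 0 := by
    intro T h hh
    -- Homogeneity in the direction turns the translate by `t • a` into a power series in `t`, whose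
    -- coefficient of degree one is `T g`.
    have h1 : ∀ t, HasSum (fun p : ℕ × ℕ => t ^ p.2 *
        (((p.1 + p.2).choose p.1 : ℂ) * T (f.part (p.1 + p.2) p.1 a))) (T (h t)) := fun t => by
      obtain ⟨u, hu, huT⟩ := exists_translate hk f (t • a)
      have : h t = u := ext fun z => by rw [hh, hu]
      rw [this]
      refine (huT T).congr_fun fun p => ?_
      rw [part_smul f (Nat.le_add_right _ _), map_smul, Nat.add_sub_cancel_left, smul_eq_mul]
      ring
    have hsw : ∀ t, HasSum (fun p : ℕ × ℕ => t ^ p.1 *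
        (((p.2 + p.1).choose p.2 : ℂ) * T (f.part (p.2 + p.1) p.2 a))) (T (h t)) := fun t =>
      (Equiv.prodComm ℕ ℕ).hasSum_iff.2 (h1 t)
    have hc : ∀ m, Summable fun n =>
        ((n + m).choose n : ℂ) * T (f.part (n + m) n a) := fun m => by
      have := (hsw 1).summable.prod_factor m
      simpa using this
    have h2 : ∀ t, HasSum (fun m => t ^ m * ∑' n, ((n + m).choose n : ℂ) *
        T (f.part (n + m) n a)) (T (h t)) := fun t =>
      (hsw t).prod_fiberwise fun m => (hc m).hasSum.mul_left (t ^ m)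
    have h3 := hasDerivAt_zero_of_hasSum_pow h2
    rwa [(hgT T).tsum_eq] at h3
  refine ⟨g, fun z => ?_, hderiv⟩
  obtain ⟨δ, hδ⟩ := exists_eval Θ hk z
  choose h hh _ using fun t : ℂ => exists_translate hk f (t • a)
  have h1 := hderiv δ h hh
  simp only [hδ, hh] at h1
  have h2 : HasDerivAt (fun t : ℂ => f (z + t • a)) (fderiv ℂ f z a) 0 := by
    have hl : HasDerivAt (fun t : ℂ => z + t • a) a 0 := by
      simpa using ((hasDerivAt_id (0 : ℂ)).smul_const a).const_add z
    have hd : HasFDerivAt (f : E → ℂ) (fderiv ℂ f z) (z + (0 : ℂ) • a) := by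
      simpa using (f.entire z (mem_univ _)).differentiableAt.hasFDerivAt
    exact hd.comp_hasDerivAt (0 : ℂ) hl
  exact h1.unique h2

/-- The convolution `T * f` belongs to `Exp^k_{Θ,0}(E)`, and depends continuously on `f`. -/
theorem exists_convolution (hk : k ≠ 0) (h₂ : IsPi2 Θ k) (T : ExpSpace Θ k →L[ℂ] ℂ)
    (ρ : Set.Ioi (0 : ℝ)) : ∃ (C : ℝ) (ρ' : Set.Ioi (0 : ℝ)), 0 ≤ C ∧
    ∀ f : ExpSpace Θ k, ∃ g : ExpSpace Θ k,
      (∀ (x : E) (h : ExpSpace Θ k), (∀ z, h z = f (z + x)) → g x = T h) ∧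
      expNorm Θ k ρ g ≤ C * expNorm Θ k ρ' f := by
  obtain ⟨C, ρ₀, hC, hT⟩ := exists_bound T
  obtain ⟨hmem, hb⟩ := h₂ T
  obtain ⟨M, hM, hbM⟩ := hb C ρ₀ hC hT
  have hρ₀ := ρ₀.2.out
  -- `j` stays a variable so that `n` can be replaced by `j - m`, the degree in which `π_{2,k}`
  -- states its conclusion. The `2` in `2 * M` bounds the binomial coefficient.
  have hQ : ∀ (f : ExpSpace Θ k) (n m j : ℕ), j = n + m →
      ∃ h : (fun x => ((n + m).choose m : ℂ) * T (f.part j m x)) ∈ Θ.space n,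
        Θ.nrm n ⟨_, h⟩ ≤ C * (2 * M) ^ (n + m) * ((ρ₀ : ℝ) ^ m)⁻¹ * weight k m *
          Θ.nrm j (taylor j f) := by
    intro f n m j hj
    have hmj : m ≤ j := by omega
    obtain rfl : n = j - m := by omega
    have h1 := hmem j m hmj _ (f.isSymm_form j) (f.diag_form_mem j)
    have h2 := hbM j m hmj _ (f.isSymm_form j) (f.diag_form_mem j)
    rw [mk_diag_form] at h2
    rw [← hj]
    have e : (fun x => (j.choose m : ℂ) * T (f.part j m x)) = (j.choose m : ℂ) • fun x =>
        T (partialExp Θ k hmj (f.isSymm_form j) (f.diag_form_mem j) x) := by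
      ext x
      rw [part_of_le f hmj]
      rfl
    refine ⟨e ▸ (Θ.space (j - m)).smul_mem _ h1, ?_⟩
    have e' : (⟨fun x => (j.choose m : ℂ) * T (f.part j m x),
        e ▸ (Θ.space (j - m)).smul_mem _ h1⟩ : Θ.space (j - m)) =
        (j.choose m : ℂ) • ⟨_, h1⟩ := Subtype.ext e
    rw [e', map_smul_eq_mul, Complex.norm_natCast]
    have h3 : (j.choose m : ℝ) ≤ 2 ^ j := by exact_mod_cast Nat.choose_le_two_pow j m
    have h4 := weight_nonneg k m
    calc _ ≤ 2 ^ j * (C * M ^ j * ((ρ₀ : ℝ) ^ m)⁻¹ * weight k m * Θ.nrm j (taylor j f)) := by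
          gcongr
      _ = _ := by rw [mul_pow]; ring
  have hterm : ∀ (ρ : Set.Ioi (0 : ℝ)) (f : ExpSpace Θ k) (p : ℕ × ℕ),
      ((ρ : ℝ) ^ p.1)⁻¹ * weight k p.1 *
        Θ.nrm p.1 ⟨_, (hQ f p.1 p.2 _ rfl).choose⟩ ≤
      C * ((2 * M * ((ρ : ℝ)⁻¹ + (ρ₀ : ℝ)⁻¹)) ^ (p.1 + p.2) * weight k (p.1 + p.2) *
        Θ.nrm (p.1 + p.2) (taylor (p.1 + p.2) f)) := by
    rintro ρ f ⟨n, m⟩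
    have hρ := ρ.2.out
    have h1 := weight_nonneg k n
    have h2 := weight_nonneg k m
    have h3 : (ρ : ℝ)⁻¹ ≤ (ρ : ℝ)⁻¹ + (ρ₀ : ℝ)⁻¹ := le_add_of_nonneg_right (by positivity)
    have h4 : (ρ₀ : ℝ)⁻¹ ≤ (ρ : ℝ)⁻¹ + (ρ₀ : ℝ)⁻¹ := le_add_of_nonneg_left (by positivity)
    calc _ ≤ ((ρ : ℝ) ^ n)⁻¹ * weight k n * (C * (2 * M) ^ (n + m) * ((ρ₀ : ℝ) ^ m)⁻¹ *
          weight k m * Θ.nrm (n + m) (taylor (n + m) f)) := by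
          gcongr
          exact (hQ f n m _ rfl).choose_spec
      _ = C * ((2 * M) ^ (n + m) * ((ρ : ℝ)⁻¹ ^ n * (ρ₀ : ℝ)⁻¹ ^ m) *
          (weight k n * weight k m) * Θ.nrm (n + m) (taylor (n + m) f)) := by
        rw [inv_pow, inv_pow]
        ring
      _ ≤ _ := by
        rw [mul_pow (2 * M), pow_add ((ρ : ℝ)⁻¹ + (ρ₀ : ℝ)⁻¹)]
        gcongr
        exact weight_mul_le k n m
  have hpos : ∀ ρ : Set.Ioi (0 : ℝ), 0 < 2 * M * ((ρ : ℝ)⁻¹ + (ρ₀ : ℝ)⁻¹) := fun ρ => by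
    have hρ := ρ.2.out
    positivity
  have hcomp := fun (ρ : Set.Ioi (0 : ℝ)) (f : ExpSpace Θ k) => summable_comp_add (fun j => by
    have := weight_nonneg k j
    have := hpos ρ
    positivity) (f.summable_two_pow_mul (hpos ρ))
  have hQs : ∀ (f : ExpSpace Θ k) (ρ : Set.Ioi (0 : ℝ)), Summable fun p : ℕ × ℕ =>
      ((ρ : ℝ) ^ p.1)⁻¹ * weight k p.1 * Θ.nrm p.1 ⟨_, (hQ f p.1 p.2 _ rfl).choose⟩ :=
    fun f ρ => Summable.of_nonneg_of_le (fun p => term_nonneg ρ p.1 _) (hterm ρ f)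
      ((hcomp ρ f).1.mul_left C)
  -- The outer factor `2` pays for the number of pairs `(n, m)` with a given sum.
  have hpos' : 0 < (2 * (2 * M * ((ρ : ℝ)⁻¹ + (ρ₀ : ℝ)⁻¹)))⁻¹ := by
    have := hpos ρ
    positivity
  refine ⟨C, ⟨_, hpos'⟩, hC.le, fun f => ?_⟩
  obtain ⟨g, hg, hgn⟩ := exists_hasSum_of_summable hk
    (fun n m => ⟨_, (hQ f n m _ rfl).choose⟩) (hQs f)
  refine ⟨g, fun x h hh => ?_, (hgn ρ).trans ?_⟩
  · obtain ⟨δ, hδ⟩ := exists_eval Θ hk x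
    obtain ⟨u, hu, huT⟩ := exists_translate hk f x
    have : h = u := ext fun z => by rw [hh, hu]
    rw [this]
    have h1 := hg δ
    simp only [hδ, ofSpace_apply] at h1
    refine h1.unique (((Equiv.prodComm ℕ ℕ).hasSum_iff.2 (huT T)).congr_fun fun p => ?_)
    simp only [Function.comp_apply, Equiv.prodComm_apply, Prod.fst_swap, Prod.snd_swap]
    rw [Nat.add_comm p.2 p.1]
  · refine ((hQs f ρ).tsum_le_tsum (hterm ρ f) ((hcomp ρ f).1.mul_left C)).trans ?_
    rw [tsum_mul_left, expNorm_apply]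
    refine mul_le_mul_of_nonneg_left ((hcomp ρ f).2.trans_eq (tsum_congr fun j => ?_)) hC.le
    rw [inv_pow, inv_inv, mul_pow 2]
    ring

/-- The operator `T *`. -/
theorem exists_isConvolutionWith (hk : k ≠ 0) (h₂ : IsPi2 Θ k) (T : ExpSpace Θ k →L[ℂ] ℂ) :
    ∃ L : ExpSpace Θ k →L[ℂ] ExpSpace Θ k, IsConvolutionWith T L := by
  choose C ρ' hC hconv using fun ρ => exists_convolution hk h₂ T ρ
  let ρ₁ : Set.Ioi (0 : ℝ) := ⟨1, Set.mem_Ioi.2 one_pos⟩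
  choose F hF _ using fun f => hconv ρ₁ f
  -- The function delivered for each `ρ` is determined by its values, so one operator satisfies all
  -- the norm estimates.
  have huniq : ∀ (f g : ExpSpace Θ k), (∀ (x : E) (h : ExpSpace Θ k),
      (∀ z, h z = f (z + x)) → g x = T h) → g = F f := fun f g hg => by
    ext x
    obtain ⟨u, hu, -⟩ := exists_translate hk f x
    rw [hg x u hu, hF f x u hu]
  let l : ExpSpace Θ k →ₗ[ℂ] ExpSpace Θ k :=
    { toFun := F
      map_add' := fun f g => by
        ext x
        obtain ⟨u, hu, -⟩ := exists_translate hk f x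
        obtain ⟨v, hv, -⟩ := exists_translate hk g x
        rw [add_apply, hF f x u hu, hF g x v hv, hF (f + g) x (u + v) fun z => by
          rw [add_apply, add_apply, hu, hv], map_add]
      map_smul' := fun c f => by
        ext x
        obtain ⟨u, hu, -⟩ := exists_translate hk f x
        rw [RingHom.id_apply, smul_apply, hF f x u hu, hF (c • f) x (c • u) fun z => by
          rw [smul_apply, smul_apply, hu], map_smul, smul_eq_mul] }
  refine ⟨⟨l, WithSeminorms.continuous_of_isBounded withSeminorms withSeminorms l fun ρ =>
    ⟨{ρ' ρ}, ⟨C ρ, hC ρ⟩, fun f => ?_⟩⟩, fun f x => ?_⟩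
  · rw [Finset.sup_singleton]
    obtain ⟨g, hg, hgn⟩ := hconv ρ f
    rw [huniq f g hg] at hgn
    exact hgn
  · obtain ⟨u, hu, -⟩ := exists_translate hk f x
    have e : (fun z => f (z + x)) = u.1 := funext fun z => (hu z).symm
    exact ⟨e ▸ u.2, hF f x _ fun z => rfl⟩

end ExpSpace

open ExpSpace

variable {Θ : HolomorphyType E} {k : ℝ≥0∞}

theorem IsConvolutionWith.apply_eq {T : ExpSpace Θ k →L[ℂ] ℂ}
    {L : ExpSpace Θ k →L[ℂ] ExpSpace Θ k} (hL : IsConvolutionWith T L) {f h : ExpSpace Θ k} {x : E}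
    (hh : ∀ z, h z = f (z + x)) : L f x = T h := by
  obtain ⟨h1, h2⟩ := hL f x
  rw [h2]
  congr 1
  ext z
  exact (hh z).symm

theorem IsConvolutionWith.isConvolutionOperator (hk : k ≠ 0) {T : ExpSpace Θ k →L[ℂ] ℂ}
    {L : ExpSpace Θ k →L[ℂ] ExpSpace Θ k} (hL : IsConvolutionWith T L) :
    IsConvolutionOperator L := by
  intro f a
  obtain ⟨g, hg, -⟩ := exists_fderiv hk f a
  have e : (fun x => fderiv ℂ f x a) = g.1 := funext fun z => (hg z).symm
  refine ⟨e ▸ g.2, fun x => ?_⟩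
  obtain ⟨w, hw, -⟩ := exists_fderiv hk (L f) a
  obtain ⟨u, hu, -⟩ := exists_translate hk f x
  obtain ⟨v, hv, hvT⟩ := exists_fderiv hk u a
  choose h hh _ using fun t : ℂ => exists_translate hk u (t • a)
  -- Translating by `x + t • a` means translating `u`, the translate by `x`, by `t • a`; so `L f` on
  -- this line is `T` on translates of `u`.
  have h1 : HasDerivAt (fun t : ℂ => L f (x + t • a)) (T v) 0 := by
    refine (hvT T h hh).congr_of_eventuallyEq (Eventually.of_forall fun t => ?_)
    refine hL.apply_eq fun z => ?_
    rw [hh, hu, add_assoc, add_comm x]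
  have h2 : HasDerivAt (fun t : ℂ => L f (x + t • a)) (fderiv ℂ (L f) x a) 0 := by
    have hl : HasDerivAt (fun t : ℂ => x + t • a) a 0 := by
      simpa using ((hasDerivAt_id (0 : ℂ)).smul_const a).const_add x
    have hd : HasFDerivAt (L f : E → ℂ) (fderiv ℂ (L f) x) (x + (0 : ℂ) • a) := by
      simpa using ((L f).entire x (mem_univ _)).differentiableAt.hasFDerivAt
    exact hd.comp_hasDerivAt (0 : ℂ) hl
  rw [← h1.unique h2]
  refine hL.apply_eq fun z => ?_
  rw [hv, show u.1 = fun z => f (z + x) from funext hu, fderiv_comp_add_right]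

/-! ### Exponentials and the Borel transform -/

section Polynomials

/-- `z ↦ (a + z b)ʲ` is the Lagrange interpolation polynomial of its values at `0, …, j`. -/
theorem exists_add_mul_pow_eq_sum (j : ℕ) : ∃ p : ℕ → Polynomial ℂ, ∀ a b z : ℂ,
    (a + z * b) ^ j = ∑ l ∈ Finset.range (j + 1), (p l).eval z * (a + l * b) ^ j := by
  refine ⟨Lagrange.basis (Finset.range (j + 1)) fun l => (l : ℂ), fun a b z => ?_⟩
  have hinj : Set.InjOn (fun l : ℕ => (l : ℂ)) (Finset.range (j + 1)) :=
    Nat.cast_injective.injOn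
  have hdeg : ((Polynomial.C a + Polynomial.X * Polynomial.C b) ^ j).degree <
      ((Finset.range (j + 1)).card : WithBot ℕ) := by
    have h1 : (Polynomial.C a + Polynomial.X * Polynomial.C b).degree ≤ ((1 : ℕ) : WithBot ℕ) := by
      compute_degree
      exact le_rfl
    rw [Finset.card_range, Polynomial.degree_lt_iff_coeff_zero]
    intro m hm
    have h2 := Polynomial.natDegree_pow_le_of_le j (Polynomial.natDegree_le_of_degree_le h1)
    exact Polynomial.coeff_eq_zero_of_natDegree_lt (by omega)
  have h := congrArg (Polynomial.eval z) (Lagrange.eq_interpolate hinj hdeg)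
  rw [Lagrange.interpolate_apply, Polynomial.eval_finsetSum] at h
  simp only [Polynomial.eval_pow, Polynomial.eval_add, Polynomial.eval_mul, Polynomial.eval_C,
    Polynomial.eval_X] at h
  rw [h]
  exact Finset.sum_congr rfl fun l _ => mul_comm _ _

end Polynomials

namespace ExpSpace

/-- The polynomial `φʲ` as an element of `P_Θ(ʲE)`. -/
noncomputable def powSpace (h₁ : IsPi1 Θ) (j : ℕ) (φ : E →L[ℂ] ℂ) : Θ.space j :=
  ⟨fun x => (φ x) ^ j, h₁.1 j (Submodule.subset_span ⟨φ, rfl⟩)⟩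

theorem exists_nrm_powSpace_le (h₁ : IsPi1 Θ) : ∃ K : ℝ, 0 < K ∧ ∀ (j : ℕ) (φ : E →L[ℂ] ℂ),
    Θ.nrm j (powSpace h₁ j φ) ≤ K ^ j * ‖φ‖ ^ j := by
  obtain ⟨K, hK, h⟩ := h₁.2.1
  refine ⟨K, hK, fun j φ => ?_⟩
  obtain ⟨hm, hn⟩ := h j φ 1
  rw [norm_one, mul_one] at hn
  refine le_of_eq_of_le (congrArg _ (Subtype.ext (funext fun x => ?_))) hn
  exact (mul_one ((φ x) ^ j)).symm

theorem summable_exp (hk : 1 < k) {K : ℝ} (hK : 0 < K) (ρ : Set.Ioi (0 : ℝ)) {r : ℝ}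
    (hr : 0 ≤ r) : Summable fun n : ℕ =>
      ((ρ : ℝ) ^ n)⁻¹ * weight k n * ((n.factorial : ℝ)⁻¹ * (K ^ n * r ^ n)) := by
  have hρ := ρ.2.out
  refine Summable.of_nonneg_of_le (fun n => ?_) (fun n => ?_)
    (summable_pow_mul_weight_div_factorial hk (R := (ρ : ℝ)⁻¹ * K * (r + 1)) (by positivity))
  · have := weight_nonneg k n
    positivity
  · have := weight_nonneg k n
    calc _ ≤ ((ρ : ℝ) ^ n)⁻¹ * weight k n * ((n.factorial : ℝ)⁻¹ * (K ^ n * (r + 1) ^ n)) := by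
          gcongr
          linarith
      _ = _ := by
        rw [mul_pow, mul_pow, inv_pow]
        ring

/-- The exponentials `e^φ` belong to `Exp^k_{Θ,0}(E)` for `k > 1`. -/
theorem exists_exp (hk : 1 < k) (h₁ : IsPi1 Θ) (φ : E →L[ℂ] ℂ) :
    ∃ g : ExpSpace Θ k, (∀ x, g x = Complex.exp (φ x)) ∧ ∀ T : ExpSpace Θ k →L[ℂ] ℂ,
      HasSum (fun n : ℕ => (n.factorial : ℂ)⁻¹ * T (ofSpace Θ k n (powSpace h₁ n φ))) (T g) := by
  have hk0 : k ≠ 0 := (zero_lt_one.trans hk).ne'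
  obtain ⟨K, hK, hb⟩ := exists_nrm_powSpace_le h₁
  obtain ⟨g, hg⟩ := exists_of_summable hk0
    (fun n => (n.factorial : ℂ)⁻¹ • powSpace h₁ n φ) fun ρ => by
    refine Summable.of_nonneg_of_le (fun n => term_nonneg ρ n _) (fun n => ?_)
      (summable_exp hk hK ρ (norm_nonneg φ))
    have := weight_nonneg k n
    have := ρ.2.out
    rw [map_smul_eq_mul, norm_inv, Complex.norm_natCast]
    gcongr
    exact hb n φ
  refine ⟨g, fun x => ?_, fun T => ?_⟩
  · refine (hasSum_taylor_apply g x).unique ?_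
    have h := NormedSpace.expSeries_div_hasSum_exp (φ x)
    rw [← Complex.exp_eq_exp_ℂ] at h
    refine h.congr_fun fun n => ?_
    rw [hg]
    exact (div_eq_inv_mul _ _).symm
  · refine (hasSum_taylor T g).congr_fun fun n => ?_
    rw [hg, map_smul, map_smul, smul_eq_mul]

/-- The function `e^φ` as an element of `Exp^k_{Θ,0}(E)`. -/
noncomputable def expFun (hk : 1 < k) (h₁ : IsPi1 Θ) (φ : E →L[ℂ] ℂ) : ExpSpace Θ k :=
  (exists_exp hk h₁ φ).choose

variable (hk : 1 < k) (h₁ : IsPi1 Θ)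

theorem expFun_apply (φ : E →L[ℂ] ℂ) (x : E) : expFun hk h₁ φ x = Complex.exp (φ x) :=
  (exists_exp hk h₁ φ).choose_spec.1 x

theorem hasSum_expFun (T : ExpSpace Θ k →L[ℂ] ℂ) (φ : E →L[ℂ] ℂ) :
    HasSum (fun n : ℕ => (n.factorial : ℂ)⁻¹ * T (ofSpace Θ k n (powSpace h₁ n φ)))
      (T (expFun hk h₁ φ)) :=
  (exists_exp hk h₁ φ).choose_spec.2 T

/-- The Borel transform `φ ↦ T(e^φ)` is holomorphic on complex lines. -/
theorem differentiable_expFun (T : ExpSpace Θ k →L[ℂ] ℂ) (φ ψ : E →L[ℂ] ℂ) :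
    Differentiable ℂ fun z : ℂ => T (expFun hk h₁ (φ + z • ψ)) := by
  obtain ⟨C, ρ, hC, hT⟩ := exists_bound T
  obtain ⟨K, hK, hb⟩ := exists_nrm_powSpace_le h₁
  have hρ := ρ.2.out
  have hterm : ∀ n : ℕ, Differentiable ℂ fun z : ℂ =>
      (n.factorial : ℂ)⁻¹ * T (ofSpace Θ k n (powSpace h₁ n (φ + z • ψ))) := by
    intro n
    -- Interpolation at `0, …, n` writes `(φ + zψ)ⁿ` through pure powers of functionals. The
    -- binomial theorem would produce mixed products, whose membership in `P_Θ(ⁿE)` would need a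
    -- separate argument.
    obtain ⟨p, hp⟩ := exists_add_mul_pow_eq_sum n
    have e : (fun z : ℂ => T (ofSpace Θ k n (powSpace h₁ n (φ + z • ψ)))) = fun z =>
        ∑ l ∈ Finset.range (n + 1), (p l).eval z *
          T (ofSpace Θ k n (powSpace h₁ n (φ + (l : ℂ) • ψ))) := by
      ext z
      have : powSpace h₁ n (φ + z • ψ) = ∑ l ∈ Finset.range (n + 1), (p l).eval z •
          powSpace h₁ n (φ + (l : ℂ) • ψ) := by
        refine Subtype.ext (funext fun x => ?_)
        rw [Submodule.coe_sum, Finset.sum_apply]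
        exact hp (φ x) (ψ x) z
      rw [this]
      simp only [map_sum, map_smul, smul_eq_mul]
    have h1 : Differentiable ℂ fun z : ℂ => T (ofSpace Θ k n (powSpace h₁ n (φ + z • ψ))) := by
      rw [e]
      exact Differentiable.fun_sum fun l _ => (p l).differentiable.mul_const _
    exact h1.const_mul _
  intro z₀
  have hd : DifferentiableOn ℂ (fun z : ℂ => ∑' n : ℕ, (n.factorial : ℂ)⁻¹ *
      T (ofSpace Θ k n (powSpace h₁ n (φ + z • ψ)))) (Metric.ball z₀ 1) := by
    refine Complex.differentiableOn_tsum_of_summable_norm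
      ((summable_exp hk hK ρ (r := ‖φ‖ + (‖z₀‖ + 1) * ‖ψ‖) (by positivity)).mul_left C)
      (fun n => (hterm n).differentiableOn) Metric.isOpen_ball fun n z hz => ?_
    have hz' : ‖z‖ ≤ ‖z₀‖ + 1 := by
      have h1 : ‖z - z₀‖ < 1 := by rwa [← dist_eq_norm]
      have := norm_le_norm_add_norm_sub' z z₀
      linarith
    have hφ : ‖φ + z • ψ‖ ≤ ‖φ‖ + (‖z₀‖ + 1) * ‖ψ‖ := by
      refine (norm_add_le _ _).trans ?_
      rw [norm_smul]
      gcongr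
    have hw := weight_nonneg k n
    rw [norm_mul, norm_inv, Complex.norm_natCast]
    calc _ ≤ (n.factorial : ℝ)⁻¹ * (C * (((ρ : ℝ) ^ n)⁻¹ * weight k n *
          Θ.nrm n (powSpace h₁ n (φ + z • ψ)))) := by
          gcongr
          exact norm_ofSpace_le hT _
      _ ≤ (n.factorial : ℝ)⁻¹ * (C * (((ρ : ℝ) ^ n)⁻¹ * weight k n *
          (K ^ n * (‖φ‖ + (‖z₀‖ + 1) * ‖ψ‖) ^ n))) := by
          gcongr
          exact (hb n _).trans (by gcongr)
      _ = _ := by ring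
  have h2 := (hd z₀ (Metric.mem_ball_self one_pos)).differentiableAt
    (Metric.ball_mem_nhds z₀ one_pos)
  refine h2.congr_of_eventuallyEq (Eventually.of_forall fun z => ?_)
  exact (hasSum_expFun hk h₁ T _).tsum_eq.symm

/-- A functional is determined, up to its value on constants, by the powers `φʲ`, `j ≥ 1`. -/
theorem map_eq_of_map_pow_eq_zero (T : ExpSpace Θ k →L[ℂ] ℂ)
    (h : ∀ (n : ℕ) (φ : E →L[ℂ] ℂ), n ≠ 0 → T (ofSpace Θ k n (powSpace h₁ n φ)) = 0)
    (f : ExpSpace Θ k) : T f = T (ofSpace Θ k 0 (taylor 0 f)) := by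
  obtain ⟨C, ρ, hC, hT⟩ := exists_bound T
  refine (hasSum_taylor T f).unique (hasSum_single 0 fun n hn => ?_)
  have h0 : ∀ Q : Θ.space n, (Q : E → ℂ) ∈ finitePoly E n → T (ofSpace Θ k n Q) = 0 := by
    rintro ⟨Q, hQm⟩ hQ
    change Q ∈ _ at hQ
    unfold finitePoly at hQ
    induction hQ using Submodule.span_induction with
    | mem x hx =>
      obtain ⟨φ, rfl⟩ := hx
      exact h n φ hn
    | zero => exact (congrArg T (map_zero (ofSpace Θ k n))).trans (map_zero T)
    | add x y hx hy ihx ihy =>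
      have hx' := h₁.1 n hx
      have hy' := h₁.1 n hy
      have e : (⟨x + y, hQm⟩ : Θ.space n) = ⟨x, hx'⟩ + ⟨y, hy'⟩ := rfl
      rw [e, map_add, map_add, ihx hx', ihy hy', add_zero]
    | smul c x hx ih =>
      have hx' := h₁.1 n hx
      have e : (⟨c • x, hQm⟩ : Θ.space n) = c • ⟨x, hx'⟩ := rfl
      rw [e, map_smul, map_smul, ih hx', smul_zero]
  set P := taylor n f
  set A : ℝ := C * (((ρ : ℝ) ^ n)⁻¹ * weight k n)
  have hA : 0 ≤ A := by
    have := weight_nonneg k n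
    have := ρ.2.out
    positivity
  rw [← norm_le_zero_iff]
  refine le_of_forall_pos_le_add fun ε hε => ?_
  -- Dividing by `A + 1` rather than `A` covers the case `A = 0`.
  obtain ⟨Q, hQ, hQε⟩ := h₁.2.2 n P (ε / (A + 1)) (by positivity)
  have h1 : T (ofSpace Θ k n P) = T (ofSpace Θ k n (P - Q)) := by
    rw [map_sub, map_sub, h0 Q hQ, sub_zero]
  rw [h1, zero_add]
  calc ‖T (ofSpace Θ k n (P - Q))‖ ≤ A * Θ.nrm n (P - Q) := by
        have := norm_ofSpace_le hT (P - Q)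
        rwa [← mul_assoc] at this
    _ ≤ (A + 1) * (ε / (A + 1)) := by
      gcongr
      linarith
    _ = ε := by field_simp

/-- `T(e^{zφ}) = ∑ zⁿ T(φⁿ)/n!` is a power series in `z` with constant sum, so its coefficients of
positive degree vanish. -/
theorem map_pow_eq_zero_of_map_expFun_eq (T : ExpSpace Θ k →L[ℂ] ℂ) (φ : E →L[ℂ] ℂ) {c : ℂ}
    (h : ∀ z : ℂ, T (expFun hk h₁ (z • φ)) = c) {n : ℕ} (hn : n ≠ 0) :
    T (ofSpace Θ k n (powSpace h₁ n φ)) = 0 := by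
  let a : ℕ → ℂ := fun n => (n.factorial : ℂ)⁻¹ * T (ofSpace Θ k n (powSpace h₁ n φ))
  have hs : ∀ z : ℂ, HasSum (fun n => z ^ n * a n) c := fun z => by
    rw [← h z]
    refine (hasSum_expFun hk h₁ T (z • φ)).congr_fun fun n => ?_
    have e : powSpace h₁ n (z • φ) = z ^ n • powSpace h₁ n φ :=
      Subtype.ext (funext fun x => mul_pow z (φ x) n)
    rw [e, map_smul, map_smul, smul_eq_mul]
    ring
  have h1 : HasFPowerSeriesAt (fun _ : ℂ => c) (FormalMultilinearSeries.ofScalars ℂ a) 0 := by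
    rw [hasFPowerSeriesAt_iff]
    exact Eventually.of_forall fun z => by
      simpa [FormalMultilinearSeries.coeff_ofScalars] using hs z
  have h2 := h1.eq_formalMultilinearSeries
    (hasFPowerSeriesOnBall_const (𝕜 := ℂ) (E := ℂ) (c := c) (e := 0)).hasFPowerSeriesAt
  have h3 := congrArg (fun p => p.coeff n) h2
  rw [FormalMultilinearSeries.coeff_ofScalars] at h3
  have h4 : a n = 0 := by
    rw [h3]
    obtain ⟨m, rfl⟩ := Nat.exists_eq_succ_of_ne_zero hn
    simp [FormalMultilinearSeries.coeff]
  have h5 : (n.factorial : ℂ)⁻¹ ≠ 0 := inv_ne_zero (Nat.cast_ne_zero.2 n.factorial_ne_zero)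
  exact (mul_eq_zero.1 h4).resolve_left h5

/-- A functional with constant Borel transform is a multiple of `δ₀`. -/
theorem exists_eq_mul_of_map_expFun_eq (T : ExpSpace Θ k →L[ℂ] ℂ)
    (h : ∀ φ : E →L[ℂ] ℂ, ∃ c : ℂ, ∀ z : ℂ, T (expFun hk h₁ (z • φ)) = c) :
    ∀ f : ExpSpace Θ k, T f = T (expFun hk h₁ 0) * f 0 := by
  intro f
  rw [map_eq_of_map_pow_eq_zero h₁ T (fun n φ hn => by
    obtain ⟨c, hc⟩ := h φ
    exact map_pow_eq_zero_of_map_expFun_eq hk h₁ T φ hc hn) f]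
  have e : ofSpace Θ k 0 (taylor 0 f) = f 0 • expFun hk h₁ 0 := by
    ext x
    rw [smul_apply, expFun_apply]
    change ((Nat.factorial 0 : ℕ) : ℂ)⁻¹ * dhat 0 f.1 0 x = _
    simp [dhat]
  rw [e, map_smul, smul_eq_mul, mul_comm]

/-- A functional that vanishes on these exponentials has a Borel transform that vanishes near `φ₀`
on each line through it, hence everywhere by the identity theorem; it is then `0 · δ₀`. Openness of
`U` at `φ₀` is needed only along lines. -/
theorem expFun_dense {U : Set (E →L[ℂ] ℂ)} {φ₀ : E →L[ℂ] ℂ}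
    (hU : ∀ ψ : E →L[ℂ] ℂ, ∀ᶠ z : ℂ in 𝓝 0, φ₀ + z • ψ ∈ U) :
    Dense (Submodule.span ℂ (expFun (Θ := Θ) hk h₁ '' U) : Set (ExpSpace Θ k)) := by
  rw [dense_iff_closure_eq]
  by_contra hne
  set M := (Submodule.span ℂ (expFun (Θ := Θ) hk h₁ '' U)).topologicalClosure
  have hM : ∃ f, f ∉ M := by
    by_contra hall
    push Not at hall
    exact hne (Set.eq_univ_of_forall hall)
  obtain ⟨f, hf⟩ := hM
  have : LocallyConvexSpace ℝ (ExpSpace Θ k) := withSeminorms.toLocallyConvexSpace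
  obtain ⟨T, u, hTu, huf⟩ := RCLike.geometric_hahn_banach_closed_point (𝕜 := ℂ)
    (s := (M : Set (ExpSpace Θ k))) (M.restrictScalars ℝ).convex
    (Submodule.isClosed_topologicalClosure _) hf
  have hu : 0 < u := by simpa using hTu 0 M.zero_mem
  have hT0 : ∀ g ∈ M, T g = 0 := by
    intro g hg
    by_contra hne
    -- If `T g ≠ 0`, a multiple of `g` attains the separating value `u` itself.
    have h1 := hTu (((u : ℂ) / T g) • g) (M.smul_mem _ hg)
    rw [map_smul, smul_eq_mul, div_mul_cancel₀ _ hne] at h1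
    simp at h1
  have hexp : ∀ φ : E →L[ℂ] ℂ, T (expFun hk h₁ φ) = 0 := by
    intro φ
    have hd := differentiable_expFun hk h₁ T φ₀ (φ - φ₀)
    have hz : (fun z : ℂ => T (expFun hk h₁ (φ₀ + z • (φ - φ₀)))) =ᶠ[𝓝 0] fun _ => 0 := by
      filter_upwards [hU (φ - φ₀)] with z hz
      exact hT0 _ (Submodule.le_topologicalClosure _ (Submodule.subset_span ⟨_, hz, rfl⟩))
    have h1 : AnalyticOnNhd ℂ (fun z : ℂ => T (expFun hk h₁ (φ₀ + z • (φ - φ₀)))) univ :=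
      fun z _ => hd.analyticAt z
    have h2 := h1.eq_of_eventuallyEq (fun _ _ => analyticAt_const) hz
    simpa using congrFun h2 1
  have h3 := exists_eq_mul_of_map_expFun_eq hk h₁ T (fun φ => ⟨0, fun z => hexp _⟩) f
  rw [hexp, zero_mul] at h3
  rw [h3] at huf
  simp at huf
  linarith

end ExpSpace

/-! ### The mixing criterion and the conclusion -/

section Mixing

variable {X : Type*} [AddCommGroup X] [Module ℂ X] [TopologicalSpace X] [IsTopologicalAddGroup X]
  [ContinuousSMul ℂ X]

/-- The Godefroy–Shapiro criterion: an operator with dense spans of the eigenvectors to eigenvalues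
of modulus `< 1` and `> 1` is mixing. -/
theorem isMixing_of_dense_eigenvectors (L : X →L[ℂ] X)
    (h₁ : Dense (Submodule.span ℂ {x | ∃ c : ℂ, ‖c‖ < 1 ∧ L x = c • x} : Set X))
    (h₂ : Dense (Submodule.span ℂ {x | ∃ c : ℂ, 1 < ‖c‖ ∧ L x = c • x} : Set X)) :
    IsMixing L := by
  have hadd : ∀ (n : ℕ) (x y : X), L^[n] (x + y) = L^[n] x + L^[n] y := fun n x y =>
    iterate_map_add L n x y
  have hsmul : ∀ (n : ℕ) (c : ℂ) (x : X), L^[n] (c • x) = c • L^[n] x := fun n c x =>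
    Function.Commute.iterate_left (fun x => map_smul L c x) n x
  have heig : ∀ (x : X) (c : ℂ), L x = c • x → ∀ n, L^[n] x = c ^ n • x := by
    intro x c hx n
    induction n with
    | zero => simp
    | succ n ih => rw [Function.iterate_succ_apply', ih, map_smul, hx, smul_smul, pow_succ]
  intro U V hU hUne hV hVne
  obtain ⟨x, hxU, hx⟩ := h₁.inter_open_nonempty U hU hUne
  obtain ⟨y, hyV, hy⟩ := h₂.inter_open_nonempty V hV hVne
  have hx0 : Tendsto (fun n => L^[n] x) atTop (𝓝 0) := by
    change x ∈ Submodule.span ℂ _ at hx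
    clear hxU
    induction hx using Submodule.span_induction with
    | mem x hx =>
      obtain ⟨c, hc, hxc⟩ := hx
      simpa [heig x c hxc] using
        (tendsto_pow_atTop_nhds_zero_of_norm_lt_one hc).smul_const x
    | zero => simpa using tendsto_const_nhds.congr fun n => (iterate_map_zero L n).symm
    | add x y _ _ hx hy => simpa [hadd] using hx.add hy
    | smul c x _ hx => simpa [hsmul] using hx.const_smul c
  -- Backward orbits are built for the single vector `y`, so no right inverse of `L` has to be
  -- defined on the whole span.
  have hy0 : ∃ u : ℕ → X, Tendsto u atTop (𝓝 0) ∧ ∀ n, L^[n] (u n) = y := by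
    change y ∈ Submodule.span ℂ _ at hy
    clear hyV
    induction hy using Submodule.span_induction with
    | mem y hy =>
      obtain ⟨c, hc, hyc⟩ := hy
      have hc0 : c ≠ 0 := norm_pos_iff.1 (one_pos.trans hc)
      refine ⟨fun n => c⁻¹ ^ n • y, ?_, fun n => ?_⟩
      · have : ‖c⁻¹‖ < 1 := by
          rw [norm_inv]
          exact inv_lt_one_of_one_lt₀ hc
        simpa using (tendsto_pow_atTop_nhds_zero_of_norm_lt_one this).smul_const y
      · rw [hsmul, heig y c hyc, smul_smul, ← mul_pow, inv_mul_cancel₀ hc0, one_pow, one_smul]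
    | zero => exact ⟨0, tendsto_const_nhds, fun n => iterate_map_zero L n⟩
    | add x y _ _ hx hy =>
      obtain ⟨u, hu, hu'⟩ := hx
      obtain ⟨v, hv, hv'⟩ := hy
      exact ⟨fun n => u n + v n, by simpa using hu.add hv, fun n => by rw [hadd, hu', hv']⟩
    | smul c x _ hx =>
      obtain ⟨u, hu, hu'⟩ := hx
      exact ⟨fun n => c • u n, by simpa using hu.const_smul c, fun n => by rw [hsmul, hu']⟩
  obtain ⟨u, hu, huy⟩ := hy0
  have hl : Tendsto (fun n => x + u n) atTop (𝓝 x) := by simpa using hu.const_add x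
  have hr : Tendsto (fun n => L^[n] x + y) atTop (𝓝 y) := by simpa using hx0.add_const y
  obtain ⟨n₀, hn₀⟩ := eventually_atTop.1
    ((hl.eventually (hU.mem_nhds hxU)).and (hr.eventually (hV.mem_nhds hyV)))
  -- The point `x + u n` is close to `x`, and `L^[n]` sends it to `L^[n] x + y`, close to `y`.
  refine ⟨n₀, fun n hn => ⟨L^[n] x + y, ⟨x + u n, (hn₀ n hn).1, ?_⟩, (hn₀ n hn).2⟩⟩
  rw [hadd, huy]

/-- A non-constant entire function takes values of modulus `> 1` and of modulus `< 1`. -/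
theorem exists_one_lt_norm_and_norm_lt_one {g : ℂ → ℂ} (hg : Differentiable ℂ g)
    (hne : ¬ ∃ c, ∀ z, g z = c) : (∃ z, 1 < ‖g z‖) ∧ ∃ z, ‖g z‖ < 1 := by
  -- Liouville's theorem, applied to `g` and then to `1 / g`.
  constructor
  · by_contra h
    push Not at h
    refine hne ⟨g 0, fun z => hg.apply_eq_apply_of_bounded ?_ z 0⟩
    exact (Metric.isBounded_closedBall (x := (0 : ℂ)) (r := 1)).subset (by
      rintro _ ⟨z, rfl⟩
      simpa using h z)
  · by_contra h
    push Not at h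
    have h0 : ∀ z, g z ≠ 0 := fun z => norm_pos_iff.1 (one_pos.trans_le (h z))
    have hi : Differentiable ℂ fun z => (g z)⁻¹ := hg.inv h0
    refine hne ⟨g 0, fun z => inv_injective (hi.apply_eq_apply_of_bounded ?_ z 0)⟩
    exact (Metric.isBounded_closedBall (x := (0 : ℂ)) (r := 1)).subset (by
      rintro _ ⟨z, rfl⟩
      simpa using inv_le_one_of_one_le₀ (h z))

end Mixing

theorem IsConvolutionWith.apply_expFun {T : ExpSpace Θ k →L[ℂ] ℂ}
    {L : ExpSpace Θ k →L[ℂ] ExpSpace Θ k} (hL : IsConvolutionWith T L) (hk : 1 < k)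
    (h₁ : IsPi1 Θ) (φ : E →L[ℂ] ℂ) :
    L (expFun hk h₁ φ) = T (expFun hk h₁ φ) • expFun hk h₁ φ := by
  ext x
  rw [hL.apply_eq (h := Complex.exp (φ x) • expFun hk h₁ φ) fun z => by
    rw [ExpSpace.smul_apply, expFun_apply, expFun_apply, map_add, Complex.exp_add, mul_comm],
    map_smul, ExpSpace.smul_apply, expFun_apply, smul_eq_mul, mul_comm]

theorem IsConvolutionWith.isMixing {T : ExpSpace Θ k →L[ℂ] ℂ}
    {L : ExpSpace Θ k →L[ℂ] ExpSpace Θ k} (hL : IsConvolutionWith T L) (hk : 1 < k)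
    (h₁ : IsPi1 Θ) (hT : ¬ ∃ c : ℂ, ∀ f : ExpSpace Θ k, T f = c * f 0) : IsMixing L := by
  obtain ⟨φ, hφ⟩ : ∃ φ : E →L[ℂ] ℂ, ¬ ∃ c : ℂ, ∀ z : ℂ, T (expFun hk h₁ (z • φ)) = c := by
    by_contra hall
    push Not at hall
    exact hT ⟨_, exists_eq_mul_of_map_expFun_eq hk h₁ T hall⟩
  have hd : Differentiable ℂ fun z : ℂ => T (expFun hk h₁ (z • φ)) := by
    simpa using differentiable_expFun hk h₁ T 0 φ
  have hcont : ∀ φ₀ ψ : E →L[ℂ] ℂ, Tendsto (fun z : ℂ => ‖T (expFun hk h₁ (φ₀ + z • ψ))‖) (𝓝 0)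
      (𝓝 ‖T (expFun hk h₁ φ₀)‖) := fun φ₀ ψ => by
    have h := ((differentiable_expFun hk h₁ T φ₀ ψ).continuous.norm).tendsto 0
    have e : φ₀ + (0 : ℂ) • ψ = φ₀ := by
      ext x
      simp
    rwa [e] at h
  obtain ⟨⟨z₁, hz₁⟩, z₂, hz₂⟩ := exists_one_lt_norm_and_norm_lt_one hd hφ
  refine isMixing_of_dense_eigenvectors L
    ((expFun_dense hk h₁ (U := {φ | ‖T (expFun hk h₁ φ)‖ < 1}) fun ψ =>
      (hcont (z₂ • φ) ψ).eventually_lt_const hz₂).mono (Submodule.span_mono ?_))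
    ((expFun_dense hk h₁ (U := {φ | 1 < ‖T (expFun hk h₁ φ)‖}) fun ψ =>
      (hcont (z₁ • φ) ψ).eventually_const_lt hz₁).mono (Submodule.span_mono ?_))
  all_goals
    rintro _ ⟨ψ, hψ, rfl⟩
    exact ⟨_, hψ, hL.apply_expFun hk h₁ ψ⟩

end HolType

theorem theorem4p7 {E : Type*} [NormedAddCommGroup E] [NormedSpace ℂ E] [CompleteSpace E]
    [TopologicalSpace.SeparableSpace (E →L[ℂ] ℂ)]
    (k : ℝ≥0∞) (hk : 1 < k)
    (Θ : HolType.HolomorphyType E) (h₁ : HolType.IsPi1 Θ) (h₂ : HolType.IsPi2 Θ k)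
    (T : HolType.ExpSpace Θ k →L[ℂ] ℂ)
    (hT : ¬ ∃ c : ℂ, ∀ f : HolType.ExpSpace Θ k, T f = c * f 0) :
    ∃ L : HolType.ExpSpace Θ k →L[ℂ] HolType.ExpSpace Θ k,
      HolType.IsConvolutionWith T L ∧
      HolType.IsConvolutionOperator L ∧
      (¬ ∃ c : ℂ, ∀ f : HolType.ExpSpace Θ k, L f = c • f) ∧
      HolType.IsMixing L := by
  have hk0 : k ≠ 0 := (zero_lt_one.trans hk).ne'
  obtain ⟨L, hL⟩ := HolType.ExpSpace.exists_isConvolutionWith hk0 h₂ T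
  refine ⟨L, hL, hL.isConvolutionOperator hk0, ?_, hL.isMixing hk h₁ hT⟩
  rintro ⟨c, hc⟩
  refine hT ⟨c, fun f => ?_⟩
  -- Evaluation at `0` recovers the functional: `T f = (L f)(0) = c * f 0`.
  rw [← hL.apply_eq (f := f) (x := 0) fun z => by rw [add_zero], hc,
    HolType.ExpSpace.smul_apply]
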